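/- Let $M$ be a compact connected smooth manifold of dimension $n\ge 3$ with a smooth Lorentz metric $g$ (signature $(-,+,\dots,+)$), and let $H$ be a connected Lie group locally isomorphic to $\mathrm{PSL}(2,\mathbf R)$ (that is, with Lie algebra $\mathfrak h\cong\mathfrak{sl}(2,\mathbf R)$) acting smoothly on $M$ by conformal transformations of $g$. For $x\in M$ and $X\in\mathfrak h$ let $X_x\in T_xM$ be the value at $x$ of the vector field generated by $X$, let $\mathfrak h_x=\{X\in\mathfrak h : X_x=0\}$ be the Lie algebra of the stabilizer of $x$, and let $q_x$ be the quadratic form on $\mathfrak h/\mathfrak h_x\cong T_x(H\cdot x)$ obtained by restricting $g_x$, i.e. $q_x(X+\mathfrak h_x)=g_x(X_x,X_x)$. Let $S<H$ be a proper, closed, connected subgroup such that $\mathrm{Ad}_{\mathfrak h}(S)\subset \mathrm{Ad}_{\mathfrak h}(H)\cong\mathrm{PSL}(2,\mathbf R)$ is not an elliptic one-parameter subgroup (a conjugate of $\mathrm{PSO}(2)$). Then every non-empty closed $S$-invariant subset of $M$ contains a point $x$ such that $\mathrm{Ad}_{\mathfrak h}(S)\mathfrak h_x\subset\mathfrak h_x$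 and such that the induced action of $\mathrm{Ad}_{\mathfrak h}(S)$ on $\mathfrak h/\mathfrak h_x$ is conformal with respect to $q_x$: for every $s\in S$ there is $c>0$ with $q_x(\overline{\mathrm{Ad}}(s)v)=c\,q_x(v)$ for all $v\in\mathfrak h/\mathfrak h_x$. -/

import Mathlib

open scoped Manifold ContDiff

noncomputable section

namespace ConformalLorentz

/-- Over `ℝ` the regularity required for the Lie algebra of a Lie group is `C^3`, so that a
smooth Lie group has a Lie algebra. -/
instance instLEInftyMinSmoothness : ENat.LEInfty (minSmoothness ℝ 3) :=
  ⟨by rw [minSmoothness_of_isRCLikeNormedField]; exact ENat.LEInfty.out⟩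

section Tangent

variable {E : Type*} [NormedAddCommGroup E] [NormedSpace ℝ E]
  {M : Type*} [TopologicalSpace M] [ChartedSpace E M]

/-- The identification of the tangent spaces at two points that are equal. -/
def tangentCast {x y : M} (h : x = y) :
    TangentSpace 𝓘(ℝ, E) x ≃L[ℝ] TangentSpace 𝓘(ℝ, E) y :=
  h ▸ ContinuousLinearEquiv.refl ℝ (TangentSpace 𝓘(ℝ, E) x)

end Tangent

section Metric

variable (E : Type*) [NormedAddCommGroup E] [NormedSpace ℝ E]
  (M : Type*) [TopologicalSpace M] [ChartedSpace E M] [IsManifold 𝓘(ℝ, E) ∞ M]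

/-- A smooth field of symmetric bilinear forms on the tangent spaces of `M`. -/
structure SymmetricTwoTensor where
  /-- the bilinear form on each tangent space -/
  val : ∀ x : M, TangentSpace 𝓘(ℝ, E) x →L[ℝ] TangentSpace 𝓘(ℝ, E) x →L[ℝ] ℝ
  symm : ∀ (x : M) (v w : TangentSpace 𝓘(ℝ, E) x), val x v w = val x w v
  contMDiff : ContMDiff 𝓘(ℝ, E) (𝓘(ℝ, E).prod 𝓘(ℝ, E →L[ℝ] E →L[ℝ] ℝ)) ∞
    (fun x : M ↦ Bundle.TotalSpace.mk' (E →L[ℝ] E →L[ℝ] ℝ)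
      (E := fun x : M ↦ TangentSpace 𝓘(ℝ, E) x →L[ℝ] TangentSpace 𝓘(ℝ, E) x →L[ℝ] ℝ) x (val x))

variable {E M}

/-- The quadratic form `v ↦ g_x(v, v)` on `T_x M`. -/
def SymmetricTwoTensor.quadraticForm (g : SymmetricTwoTensor E M) (x : M) :
    QuadraticForm ℝ (TangentSpace 𝓘(ℝ, E) x) :=
  LinearMap.BilinMap.toQuadraticMap
    (ContinuousLinearMap.coeLM ℝ ∘ₗ (g.val x).toLinearMap)

variable (E M)

/-- A smooth Lorentz metric, of signature `(-, +, …, +)` at each point; it is nondegenerate, since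
the two indices add up to the dimension. -/
structure LorentzMetric extends SymmetricTwoTensor E M where
  sigNeg_eq : ∀ x : M, sigNeg (toSymmetricTwoTensor.quadraticForm x) = 1
  sigPos_eq : ∀ x : M,
    sigPos (toSymmetricTwoTensor.quadraticForm x) + 1 = Module.finrank ℝ E

variable {E M}

/-- `f^* g = λ g` for some smooth positive function `λ`. -/
def LorentzMetric.IsConformal (g : LorentzMetric E M) (f : M → M) : Prop :=
  ∃ c : M → ℝ, ContMDiff 𝓘(ℝ, E) 𝓘(ℝ, ℝ) ∞ c ∧ (∀ x, 0 < c x) ∧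
    ∀ (x : M) (v w : TangentSpace 𝓘(ℝ, E) x),
      g.val (f x) (mfderiv 𝓘(ℝ, E) 𝓘(ℝ, E) f x v) (mfderiv 𝓘(ℝ, E) 𝓘(ℝ, E) f x w)
        = c x * g.val x v w

end Metric

section Adjoint

variable {EH : Type*} [NormedAddCommGroup EH] [NormedSpace ℝ EH]
  {H : Type*} [TopologicalSpace H] [ChartedSpace EH H] [Group H]

/-- The adjoint representation: `Ad h` is the differential at the identity
of the conjugation `k ↦ h k h⁻¹`. -/
def Ad (h : H) : GroupLieAlgebra 𝓘(ℝ, EH) H →L[ℝ] GroupLieAlgebra 𝓘(ℝ, EH) H :=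
  (tangentCast (by simp : h * 1 * h⁻¹ = 1)).toContinuousLinearMap ∘L
    mfderiv 𝓘(ℝ, EH) 𝓘(ℝ, EH) (fun k : H ↦ h * k * h⁻¹) 1

/-- The rotation of angle `θ`. -/
def rotationMatrix (θ : ℝ) : Matrix (Fin 2) (Fin 2) ℝ :=
  !![Real.cos θ, -Real.sin θ; Real.sin θ, Real.cos θ]

/-- A set `A` of endomorphisms of the Lie algebra `𝔥 ≅ 𝔰𝔩(2, ℝ)` is an elliptic one-parameter
subgroup if some identification `𝔥 ≅ 𝔰𝔩(2, ℝ)` turns it into the image of `SO(2)` under the adjoint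
representation of `SL(2, ℝ)`. (The elliptic one-parameter subgroups of `PSL(2, ℝ)` are the
conjugates of `PSO(2)`; conjugating amounts to changing the identification, and every change of
identification is an automorphism of `𝔰𝔩(2, ℝ)`, which is conjugation by an element
of `GL(2, ℝ)`.) -/
def IsEllipticOneParameterSubgroup [FiniteDimensional ℝ EH] [LieGroup 𝓘(ℝ, EH) ∞ H]
    (A : Set (GroupLieAlgebra 𝓘(ℝ, EH) H →L[ℝ] GroupLieAlgebra 𝓘(ℝ, EH) H)) : Prop :=
  ∃ e : GroupLieAlgebra 𝓘(ℝ, EH) H ≃ₗ⁅ℝ⁆ LieAlgebra.SpecialLinear.sl (Fin 2) ℝ,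
    ∀ T : GroupLieAlgebra 𝓘(ℝ, EH) H →L[ℝ] GroupLieAlgebra 𝓘(ℝ, EH) H,
      T ∈ A ↔ ∃ θ : ℝ, ∀ X : GroupLieAlgebra 𝓘(ℝ, EH) H,
        (e (T X) : Matrix (Fin 2) (Fin 2) ℝ) = rotationMatrix θ * (e X).1 * rotationMatrix (-θ)

end Adjoint

section Action

variable (EH : Type*) [NormedAddCommGroup EH] [NormedSpace ℝ EH]
  (H : Type*) [TopologicalSpace H] [ChartedSpace EH H] [Group H]
  {E : Type*} [NormedAddCommGroup E] [NormedSpace ℝ E]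
  {M : Type*} [TopologicalSpace M] [ChartedSpace E M] [MulAction H M]

/-- The infinitesimal action at `x`, i.e. the differential at the identity of the orbit map
`h ↦ h • x`. (The opposite sign convention gives the same kernel and the same quadratic form.) -/
def infinitesimalAction (x : M) : GroupLieAlgebra 𝓘(ℝ, EH) H →L[ℝ] TangentSpace 𝓘(ℝ, E) x :=
  (tangentCast (one_smul H x)).toContinuousLinearMap ∘L
    mfderiv 𝓘(ℝ, EH) 𝓘(ℝ, E) (fun h : H ↦ h • x) 1

/-- The Lie algebra `𝔥_x = {X ∈ 𝔥 | X_x = 0}` of the stabilizer of `x`. -/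
def isotropyAlgebra (x : M) : Submodule ℝ (GroupLieAlgebra 𝓘(ℝ, EH) H) :=
  LinearMap.ker (infinitesimalAction EH H (E := E) x).toLinearMap

/-- The injective linear map `𝔥 / 𝔥_x → T_x M`, whose image is the tangent space
of the orbit of `x`. -/
def orbitTangentMap (x : M) :
    (GroupLieAlgebra 𝓘(ℝ, EH) H ⧸ isotropyAlgebra EH H (E := E) x) →ₗ[ℝ]
      TangentSpace 𝓘(ℝ, E) x :=
  (isotropyAlgebra EH H (E := E) x).liftQ (infinitesimalAction EH H (E := E) x).toLinearMap le_rfl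

variable [IsManifold 𝓘(ℝ, E) ∞ M]

/-- The quadratic form `q_x` on `𝔥 / 𝔥_x ≅ T_x(H • x)` obtained by restricting `g_x`. -/
def orbitQuadraticForm (g : LorentzMetric E M) (x : M) :
    QuadraticForm ℝ (GroupLieAlgebra 𝓘(ℝ, EH) H ⧸ isotropyAlgebra EH H (E := E) x) :=
  (g.quadraticForm x).comp (orbitTangentMap EH H (E := E) x)

end Action

end ConformalLorentz

end

/-! Everything takes place on the three-dimensional space `𝔥`. Pull `g_x` back to a form `Q_x` on
`𝔥` (`pullbackForm`). Under `h`, the isotropy algebra at `x` is carried by `Ad h` to the one at `h •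
x`, and `Q_x` to a positive multiple of `Q_{h • x}`. Both depend on `x` well enough to pass to
limits: `Q_x` is continuous, and isotropy algebras are locally kernels of continuous families of
linear maps (`IsKernelFamily`). The theorem asks for a point of `F` whose pair (isotropy algebra,
form up to scale) is fixed by `Ad S`.

Algebra. The tangent space of `S` at the identity is an `Ad S`-invariant subspace of `𝔥`, nonzero
and proper if `S` is nontrivial (`exists_Ad_invariant_submodule`). A connected group of
automorphisms of `𝔰𝔩(2, ℝ)` with such a subspace has an invariant line, and either lies in a Borel
group or consists of all rotations (`IsSl2Basis.borel_or_elliptic`). The second case is the excluded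
elliptic one.

Dynamics. A unipotent element, or a diagonal one after rescaling, has powers on a polynomial curve
`D(u)` of degree two. Moving `x` by the inverse powers `c ^ (-i)` replaces `Q_x` by multiples of
`Q_x ∘ D(u_i)`. By compactness of `F` these converge along an ultrafilter, and the limit must be a
multiple of the leading coefficient in `u`. Composition with an element `R` of the one-parameter
group only reparametrizes the curve, asymptotically by a factor `χ`, so it multiplies the leading
coefficient of degree `m` by `χ ^ m`. The limit is therefore fixed up to scale by the entire
one-parameter group (`exists_form_invariant`). The same mechanism handles isotropy algebras of
maximal dimension (`exists_kernel_invariant`): maximality forces the limit algebra to equal the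
invariant subspace found inside it.

The Borel group is solvable, so these fixed points are found successively
(`IsEquivariantFamily.exists_fixed_of_borel`): first for the unipotent part, whose fixed locus is
compact and invariant because that part is normal, then for a hyperbolic element acting on this
locus. -/

open scoped Manifold ContDiff

noncomputable section

namespace ConformalLorentz

/-! ### Derivatives read in the model spaces -/

section ModelDerivative

variable {E : Type*} [NormedAddCommGroup E] [NormedSpace ℝ E]
  {M : Type*} [TopologicalSpace M] [ChartedSpace E M]
  {E' : Type*} [NormedAddCommGroup E'] [NormedSpace ℝ E']
  {M' : Type*} [TopologicalSpace M'] [ChartedSpace E' M']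
  {E'' : Type*} [NormedAddCommGroup E''] [NormedSpace ℝ E'']
  {M'' : Type*} [TopologicalSpace M''] [ChartedSpace E'' M'']

/-- The identification of equal tangent spaces is the identity of the model space. -/
lemma tangentCast_apply {x y : M} (h : x = y) (v : TangentSpace 𝓘(ℝ, E) x) :
    (tangentCast h v : E) = v := by
  subst h; rfl

variable (E E') in
/-- The derivative of a map between manifolds, as a map between the model spaces. -/
def modelDeriv (f : M → M') (x : M) : E →L[ℝ] E' := mfderiv 𝓘(ℝ, E) 𝓘(ℝ, E') f x

lemma modelDeriv_comp {g : M' → M''} {f : M → M'} (x : M)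
    (hg : MDifferentiableAt 𝓘(ℝ, E') 𝓘(ℝ, E'') g (f x))
    (hf : MDifferentiableAt 𝓘(ℝ, E) 𝓘(ℝ, E') f x) :
    modelDeriv E E'' (g ∘ f) x = modelDeriv E' E'' g (f x) ∘L modelDeriv E E' f x :=
  mfderiv_comp (I' := 𝓘(ℝ, E')) x hg hf

lemma modelDeriv_id (x : M) : modelDeriv E E (id : M → M) x = ContinuousLinearMap.id ℝ E :=
  mfderiv_id

end ModelDerivative

/-! ### The adjoint action by Lie algebra automorphisms -/

section Adjoint

variable {EH : Type*} [NormedAddCommGroup EH] [NormedSpace ℝ EH]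
  {H : Type*} [TopologicalSpace H] [ChartedSpace EH H] [Group H]

lemma Ad_apply (h : H) (X : GroupLieAlgebra 𝓘(ℝ, EH) H) :
    (Ad h X : EH) = modelDeriv EH EH (fun k : H ↦ h * k * h⁻¹) 1 (X : EH) :=
  tangentCast_apply _ _

lemma Ad_one_apply (X : GroupLieAlgebra 𝓘(ℝ, EH) H) : Ad (1 : H) X = X := by
  have h : (fun k : H ↦ 1 * k * 1⁻¹) = id := by ext k; simp
  refine (Ad_apply 1 X).trans ?_
  rw [h, modelDeriv_id]; rfl

variable [LieGroup 𝓘(ℝ, EH) ∞ H]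

lemma contMDiff_conj (h : H) :
    ContMDiff 𝓘(ℝ, EH) 𝓘(ℝ, EH) ∞ (fun k : H ↦ h * k * h⁻¹) :=
  (contMDiff_const.mul contMDiff_id).mul contMDiff_const

lemma mdifferentiableAt_conj (h k : H) :
    MDifferentiableAt 𝓘(ℝ, EH) 𝓘(ℝ, EH) (fun k : H ↦ h * k * h⁻¹) k :=
  (contMDiff_conj h).mdifferentiableAt (by simp)

lemma Ad_mul_apply (a b : H) (X : GroupLieAlgebra 𝓘(ℝ, EH) H) :
    Ad (a * b) X = Ad a (Ad b X) := by
  have h : (fun k : H ↦ a * b * k * (a * b)⁻¹) =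
      (fun k : H ↦ a * k * a⁻¹) ∘ fun k : H ↦ b * k * b⁻¹ := by
    ext k; simp [mul_assoc]
  have key : modelDeriv EH EH (fun k : H ↦ a * b * k * (a * b)⁻¹) 1 =
      modelDeriv EH EH (fun k : H ↦ a * k * a⁻¹) 1 ∘L
        modelDeriv EH EH (fun k : H ↦ b * k * b⁻¹) 1 := by
    rw [h, modelDeriv_comp _ (mdifferentiableAt_conj a _) (mdifferentiableAt_conj b _)]
    simp
  refine (Ad_apply (a * b) X).trans (Eq.trans ?_ (Ad_apply a (Ad b X)).symm)
  rw [Ad_apply]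
  exact DFunLike.congr_fun key X

lemma Ad_inv_apply_Ad (a : H) (X : GroupLieAlgebra 𝓘(ℝ, EH) H) : Ad a⁻¹ (Ad a X) = X := by
  rw [← Ad_mul_apply, inv_mul_cancel, Ad_one_apply]

lemma mdifferentiableAt_mul_left (a b : H) :
    MDifferentiableAt 𝓘(ℝ, EH) 𝓘(ℝ, EH) (fun k : H ↦ a * k) b :=
  (contMDiff_mul_left (I := 𝓘(ℝ, EH)) (n := ∞)).mdifferentiableAt (by simp)

open VectorField

/-- Differentiate `h (g k) h⁻¹ = (h g h⁻¹)(h k h⁻¹)` at `k = 1`. Thus conjugation relates two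
left-invariant fields, and naturality of the bracket applies in `Ad_lie`. -/
lemma modelDeriv_conj_mulInvariantVectorField (h g : H) (X : GroupLieAlgebra 𝓘(ℝ, EH) H) :
    modelDeriv EH EH (fun k : H ↦ h * k * h⁻¹) g (mulInvariantVectorField X g : EH) =
      (mulInvariantVectorField (Ad h X) (h * g * h⁻¹) : EH) := by
  have e : (fun k : H ↦ h * k * h⁻¹) ∘ (fun k : H ↦ g * k) =
      (fun k : H ↦ h * g * h⁻¹ * k) ∘ (fun k : H ↦ h * k * h⁻¹) := by
    ext k; simp [mul_assoc]
  have e1 := modelDeriv_comp (E := EH) (E' := EH) (E'' := EH) (1 : H)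
    (mdifferentiableAt_conj h (g * 1)) (mdifferentiableAt_mul_left g 1)
  have e2 := modelDeriv_comp (E := EH) (E' := EH) (E'' := EH) (1 : H)
    (mdifferentiableAt_mul_left (h * g * h⁻¹) (h * 1 * h⁻¹)) (mdifferentiableAt_conj h 1)
  rw [e, e2] at e1
  simp only [mul_one, mul_inv_cancel] at e1
  refine (DFunLike.congr_fun e1 X).symm.trans ?_
  exact congrArg (modelDeriv EH EH (fun k : H ↦ h * g * h⁻¹ * k) 1) (Ad_apply h X).symm

lemma isInvertible_modelDeriv_conj (h g : H) :
    (modelDeriv EH EH (fun k : H ↦ h * k * h⁻¹) g : EH →L[ℝ] EH).IsInvertible := by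
  have key : ∀ h g : H, modelDeriv EH EH (fun k : H ↦ h⁻¹ * k * h⁻¹⁻¹) (h * g * h⁻¹) ∘L
      modelDeriv EH EH (fun k : H ↦ h * k * h⁻¹) g = ContinuousLinearMap.id ℝ EH := fun h g ↦ by
    have := modelDeriv_comp (E := EH) (E' := EH) (E'' := EH) g
      (mdifferentiableAt_conj h⁻¹ (h * g * h⁻¹)) (mdifferentiableAt_conj h g)
    rw [← this]
    have : (fun k : H ↦ h⁻¹ * k * h⁻¹⁻¹) ∘ (fun k : H ↦ h * k * h⁻¹) = id := by
      ext k; simp [mul_assoc]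
    rw [this, modelDeriv_id]
  have key' : modelDeriv EH EH (fun k : H ↦ h * k * h⁻¹) g ∘L
      modelDeriv EH EH (fun k : H ↦ h⁻¹ * k * h⁻¹⁻¹) (h * g * h⁻¹) =
        ContinuousLinearMap.id ℝ EH := by
    have := key h⁻¹ (h * g * h⁻¹)
    simpa [mul_assoc] using this
  exact ⟨ContinuousLinearEquiv.equivOfInverse _ _ (DFunLike.congr_fun (key h g))
    (DFunLike.congr_fun key'), rfl⟩

variable [FiniteDimensional ℝ EH]

/-- The adjoint action preserves the Lie bracket. -/
lemma Ad_lie (h : H) (X Y : GroupLieAlgebra 𝓘(ℝ, EH) H) : Ad h ⁅X, Y⁆ = ⁅Ad h X, Ad h Y⁆ := by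
  have hp : ∀ X : GroupLieAlgebra 𝓘(ℝ, EH) H,
      mpullback 𝓘(ℝ, EH) 𝓘(ℝ, EH) (fun k : H ↦ h * k * h⁻¹) (mulInvariantVectorField (Ad h X)) =
        mulInvariantVectorField X := fun X ↦ by
    funext g
    have e := modelDeriv_conj_mulInvariantVectorField h g X
    obtain ⟨L, hL⟩ := isInvertible_modelDeriv_conj (EH := EH) h g
    rw [← hL] at e
    have : mpullback 𝓘(ℝ, EH) 𝓘(ℝ, EH) (fun k : H ↦ h * k * h⁻¹)
        (mulInvariantVectorField (Ad h X)) g =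
        ((modelDeriv EH EH (fun k : H ↦ h * k * h⁻¹) g).inverse : EH →L[ℝ] EH)
          (mulInvariantVectorField (Ad h X) (h * g * h⁻¹) : EH) := rfl
    refine this.trans ?_
    rw [← hL, ← e, ContinuousLinearMap.inverse_equiv]
    exact L.symm_apply_apply _
  have : CompleteSpace EH := FiniteDimensional.complete ℝ EH
  have hb := mpullback_mlieBracket (n := minSmoothness ℝ 3) (x₀ := (1 : H))
    (f := fun k : H ↦ h * k * h⁻¹)
    (V := mulInvariantVectorField (Ad h X)) (W := mulInvariantVectorField (Ad h Y))
    (I := 𝓘(ℝ, EH)) (I' := 𝓘(ℝ, EH))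
    (mdifferentiableAt_mulInvariantVectorField _) (mdifferentiableAt_mulInvariantVectorField _)
    (((contMDiff_conj h).of_le ENat.LEInfty.out).contMDiffAt)
    (minSmoothness_monotone (by norm_cast))
  rw [hp, hp] at hb
  obtain ⟨L, hL⟩ := isInvertible_modelDeriv_conj (EH := EH) h 1
  have hb' : ((modelDeriv EH EH (fun k : H ↦ h * k * h⁻¹) 1).inverse : EH →L[ℝ] EH)
      (mlieBracket 𝓘(ℝ, EH) (mulInvariantVectorField (Ad h X))
        (mulInvariantVectorField (Ad h Y)) (h * 1 * h⁻¹)) = (⁅X, Y⁆ :) := hb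
  refine (Ad_apply h _).trans ?_
  rw [← hb', ← hL, ContinuousLinearMap.inverse_equiv]
  refine (L.apply_symm_apply _).trans ?_
  -- The bracket is taken at `h * 1 * h⁻¹`, which equals `1` only propositionally; generalizing the
  -- point permits substitution.
  have : ∀ k : H, k = 1 → (mlieBracket 𝓘(ℝ, EH) (mulInvariantVectorField (Ad h X))
        (mulInvariantVectorField (Ad h Y)) k : EH) = (⁅Ad h X, Ad h Y⁆ :) := by
    rintro k rfl; rfl
  exact this _ (by simp)

end Adjoint

/-! ### Continuous dependence of derivatives on parameters -/

section ParametrizedDerivative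

variable {E : Type*} [NormedAddCommGroup E] [NormedSpace ℝ E]
  {M : Type*} [TopologicalSpace M] [ChartedSpace E M] [IsManifold 𝓘(ℝ, E) ∞ M]
  {E' : Type*} [NormedAddCommGroup E'] [NormedSpace ℝ E']
  {M' : Type*} [TopologicalSpace M'] [ChartedSpace E' M'] [IsManifold 𝓘(ℝ, E') ∞ M']
  {F : Type*} [NormedAddCommGroup F] [NormedSpace ℝ F]
  {N : Type*} [TopologicalSpace N] [ChartedSpace F N] [IsManifold 𝓘(ℝ, F) ∞ N]

variable (E M) in
/-- The coordinate change of the tangent bundle at `x`, from the preferred chart at `x` to the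
preferred chart at `y`. -/
def tangentCoord (x y : M) : E →L[ℝ] E :=
  haveI : IsManifold 𝓘(ℝ, E) 1 M := IsManifold.of_le (n := ∞) (by simp)
  (tangentBundleCore 𝓘(ℝ, E) M).coordChange (achart E x) (achart E y) x

lemma tangentCoord_self (x : M) : tangentCoord E M x x = ContinuousLinearMap.id ℝ E := by
  have : IsManifold 𝓘(ℝ, E) 1 M := IsManifold.of_le (n := ∞) (by simp)
  ext v
  exact (tangentBundleCore 𝓘(ℝ, E) M).coordChange_self _ _ (mem_chart_source E x) v

lemma tangentCoord_injective {x y : M} (h : x ∈ (chartAt E y).source) :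
    Function.Injective (tangentCoord E M x y) := by
  have : IsManifold 𝓘(ℝ, E) 1 M := IsManifold.of_le (n := ∞) (by simp)
  refine Function.LeftInverse.injective
    (g := (tangentBundleCore 𝓘(ℝ, E) M).coordChange (achart E y) (achart E x) x) fun v ↦ ?_
  have := (tangentBundleCore 𝓘(ℝ, E) M).coordChange_comp (achart E x) (achart E y) (achart E x)
    x ⟨⟨mem_chart_source E x, h⟩, mem_chart_source E x⟩ v
  exact this.trans ((tangentBundleCore 𝓘(ℝ, E) M).coordChange_self _ _ (mem_chart_source E x) v)

/-- The derivative of a map depends continuously on a parameter. -/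
lemma contMDiffAt_tangentCoord_comp_modelDeriv (f : N → M → M') (z₀ : N) (x₀ : M)
    (hf : ContMDiffAt (𝓘(ℝ, F).prod 𝓘(ℝ, E)) 𝓘(ℝ, E') ∞ (Function.uncurry f) (z₀, x₀)) :
    ContMDiffAt 𝓘(ℝ, F) 𝓘(ℝ, E →L[ℝ] E') 0 (fun z ↦
      tangentCoord E' M' (f z x₀) (f z₀ x₀) ∘L modelDeriv E E' (f z) x₀) z₀ := by
  have : IsManifold 𝓘(ℝ, E) 1 M := IsManifold.of_le (n := ∞) (by simp)
  have : IsManifold 𝓘(ℝ, E') 1 M' := IsManifold.of_le (n := ∞) (by simp)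
  have h := ContMDiffAt.mfderiv (I := 𝓘(ℝ, E)) (I' := 𝓘(ℝ, E')) (J := 𝓘(ℝ, F))
      (m := 0) f (fun _ ↦ x₀) hf contMDiffAt_const (by simp)
  refine h.congr_of_eventuallyEq ?_
  have hc : ContinuousAt (fun z ↦ f z x₀) z₀ :=
    hf.continuousAt.comp (f := fun z ↦ (z, x₀)) (by fun_prop)
  filter_upwards [hc.preimage_mem_nhds ((chartAt E' (f z₀ x₀)).open_source.mem_nhds
    (mem_chart_source E' _))] with z hz
  refine Eq.trans ?_ (inTangentCoordinates_eq (I := 𝓘(ℝ, E)) (I' := 𝓘(ℝ, E')) (fun _ ↦ x₀)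
    (fun z ↦ f z x₀) (fun z ↦ modelDeriv E E' (f z) x₀) (mem_chart_source E x₀) hz).symm
  -- The base point in the source is constant, so only the coordinate change in the target survives.
  have h1 : (tangentBundleCore 𝓘(ℝ, E) M).coordChange (achart E x₀) (achart E x₀) x₀ =
      ContinuousLinearMap.id ℝ E := tangentCoord_self (E := E) x₀
  rw [h1]
  rfl

end ParametrizedDerivative

/-! ### Continuity of the adjoint action -/

section AdContinuous
variable {EH : Type*} [NormedAddCommGroup EH] [NormedSpace ℝ EH]
  {H : Type*} [TopologicalSpace H] [ChartedSpace EH H] [Group H] [LieGroup 𝓘(ℝ, EH) ∞ H]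

/-- The adjoint action depends continuously on the group element. -/
lemma continuous_Ad_apply (X : GroupLieAlgebra 𝓘(ℝ, EH) H) :
    Continuous fun h : H ↦ Ad h X := by
  have h0 : ∀ h₀ : H, ContinuousAt
      (fun h : H ↦ (modelDeriv EH EH (fun k : H ↦ h * k * h⁻¹) 1 : EH →L[ℝ] EH)) h₀ := by
    intro h₀
    have hs : ContMDiffAt (𝓘(ℝ, EH).prod 𝓘(ℝ, EH)) 𝓘(ℝ, EH) ∞
        (Function.uncurry fun h k : H ↦ h * k * h⁻¹) (h₀, 1) :=
      (((contMDiff_fst.mul contMDiff_snd).mul contMDiff_fst.inv)).contMDiffAt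
    have := (contMDiffAt_tangentCoord_comp_modelDeriv _ h₀ 1 hs).continuousAt
    simpa [tangentCoord_self] using this
  refine continuous_iff_continuousAt.2 fun h₀ ↦ ?_
  exact ((h0 h₀).clm_apply continuousAt_const).congr
    (Filter.Eventually.of_forall fun h ↦ (Ad_apply h X).symm)

end AdContinuous

/-! ### Equivariance and continuity of isotropy algebras and forms -/

section Action
variable {EH : Type*} [NormedAddCommGroup EH] [NormedSpace ℝ EH]
  {H : Type*} [TopologicalSpace H] [ChartedSpace EH H] [Group H]
  {E : Type*} [NormedAddCommGroup E] [NormedSpace ℝ E]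
  {M : Type*} [TopologicalSpace M] [ChartedSpace E M] [MulAction H M]

lemma infinitesimalAction_apply (x : M) (X : GroupLieAlgebra 𝓘(ℝ, EH) H) :
    (infinitesimalAction EH H (E := E) x X : E) = modelDeriv EH E (fun h : H ↦ h • x) 1 X :=
  tangentCast_apply _ _

lemma mem_isotropyAlgebra {x : M} {X : GroupLieAlgebra 𝓘(ℝ, EH) H} :
    X ∈ isotropyAlgebra EH H (E := E) x ↔ infinitesimalAction EH H (E := E) x X = 0 :=
  Iff.rfl

variable (EH H) in
/-- The pull-back of the metric by the infinitesimal action. -/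
def pullbackForm [IsManifold 𝓘(ℝ, E) ∞ M] (g : LorentzMetric E M) (x : M) :
    QuadraticForm ℝ (GroupLieAlgebra 𝓘(ℝ, EH) H) :=
  (g.quadraticForm x).comp (infinitesimalAction EH H (E := E) x).toLinearMap

lemma pullbackForm_apply [IsManifold 𝓘(ℝ, E) ∞ M] (g : LorentzMetric E M) (x : M)
    (X : GroupLieAlgebra 𝓘(ℝ, EH) H) :
    pullbackForm EH H g x X =
      g.val x (infinitesimalAction EH H x X) (infinitesimalAction EH H x X) := rfl

variable [ContMDiffSMul 𝓘(ℝ, EH) 𝓘(ℝ, E) ∞ H M]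

lemma mdifferentiableAt_smul_const (x : M) (h : H) :
    MDifferentiableAt 𝓘(ℝ, EH) 𝓘(ℝ, E) (fun h : H ↦ h • x) h :=
  ((contMDiff_smul (I := 𝓘(ℝ, EH)) (I' := 𝓘(ℝ, E)) (n := ∞) (G := H) (M := M)).comp
    (contMDiff_id.prodMk contMDiff_const)).mdifferentiableAt (by simp)

variable [LieGroup 𝓘(ℝ, EH) ∞ H]

/-- Equivariance of the infinitesimal action. -/
lemma infinitesimalAction_smul (h : H) (x : M) (X : GroupLieAlgebra 𝓘(ℝ, EH) H) :
    infinitesimalAction EH H (E := E) (h • x) (Ad h X) =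
      mfderiv 𝓘(ℝ, E) 𝓘(ℝ, E) (fun y : M ↦ h • y) x (infinitesimalAction EH H (E := E) x X) := by
  have e : (fun k : H ↦ k • (h • x)) ∘ (fun k : H ↦ h * k * h⁻¹) =
      (fun y : M ↦ h • y) ∘ (fun k : H ↦ k • x) := by
    ext k; simp [mul_smul]
  have e1 := modelDeriv_comp (E := EH) (E' := EH) (E'' := E) (1 : H)
    (mdifferentiableAt_smul_const (h • x) (h * 1 * h⁻¹)) (mdifferentiableAt_conj h 1)
  have e2 := modelDeriv_comp (E := EH) (E' := E) (E'' := E) (1 : H)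
    (((contMDiff_smul (I := 𝓘(ℝ, EH)) (I' := 𝓘(ℝ, E)) (n := ∞) (G := H) (M := M)).comp
      (contMDiff_const (c := h) |>.prodMk contMDiff_id)).mdifferentiableAt (by simp))
    (mdifferentiableAt_smul_const x 1)
  rw [e] at e1
  replace e1 := e2.symm.trans e1
  simp only [mul_one, mul_inv_cancel, one_smul] at e1
  refine (infinitesimalAction_apply _ _).trans ?_
  have e3 := DFunLike.congr_fun e1 X
  refine Eq.trans (congrArg _ (Ad_apply h X)) (e3.symm.trans ?_)
  exact congrArg (modelDeriv E E (fun y : M ↦ h • y) x) (infinitesimalAction_apply x X).symm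

lemma Ad_mem_isotropyAlgebra_smul (h : H) {x : M} {X : GroupLieAlgebra 𝓘(ℝ, EH) H}
    (hX : X ∈ isotropyAlgebra EH H (E := E) x) :
    Ad h X ∈ isotropyAlgebra EH H (E := E) (h • x) := by
  rw [mem_isotropyAlgebra] at hX ⊢
  rw [infinitesimalAction_smul, hX, map_zero]

lemma Ad_mem_isotropyAlgebra_smul_iff (h : H) {x : M} {X : GroupLieAlgebra 𝓘(ℝ, EH) H} :
    Ad h X ∈ isotropyAlgebra EH H (E := E) (h • x) ↔ X ∈ isotropyAlgebra EH H (E := E) x := by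
  refine ⟨fun hX ↦ ?_, Ad_mem_isotropyAlgebra_smul h⟩
  have := Ad_mem_isotropyAlgebra_smul h⁻¹ hX
  rwa [Ad_inv_apply_Ad, inv_smul_smul] at this

variable [IsManifold 𝓘(ℝ, E) ∞ M]

lemma contMDiffAt_tangentCoord_comp_infinitesimalAction (x₀ : M) :
    ContMDiffAt 𝓘(ℝ, E) 𝓘(ℝ, EH →L[ℝ] E) 0 (fun x : M ↦
      tangentCoord E M x x₀ ∘L modelDeriv EH E (fun h : H ↦ h • x) 1) x₀ := by
  have hs : ContMDiffAt (𝓘(ℝ, E).prod 𝓘(ℝ, EH)) 𝓘(ℝ, E) ∞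
      (Function.uncurry fun (x : M) (h : H) ↦ h • x) (x₀, 1) :=
    ((contMDiff_smul (I := 𝓘(ℝ, EH)) (I' := 𝓘(ℝ, E)) (n := ∞) (G := H) (M := M)).comp
      (contMDiff_snd.prodMk contMDiff_fst)).contMDiffAt
  have := contMDiffAt_tangentCoord_comp_modelDeriv _ x₀ 1 hs
  simpa using this

/-- Near each point the isotropy algebras are the kernels of linear maps that depend continuously
on the point. -/
lemma exists_continuousAt_ker_eq_isotropyAlgebra (x₀ : M) :
    ∃ A : M → GroupLieAlgebra 𝓘(ℝ, EH) H →ₗ[ℝ] E, (∀ X, ContinuousAt (fun x ↦ A x X) x₀) ∧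
      ∀ᶠ x in nhds x₀, ∀ X, A x X = 0 ↔ X ∈ isotropyAlgebra EH H (E := E) x := by
  refine ⟨fun x ↦ (tangentCoord E M x x₀ ∘L
    modelDeriv EH E (fun h : H ↦ h • x) 1 : EH →L[ℝ] E).toLinearMap, fun X ↦ ?_, ?_⟩
  · have h := (contMDiffAt_tangentCoord_comp_infinitesimalAction (E := E) (EH := EH) (H := H)
      x₀).continuousAt
    let v : EH := X
    exact h.clm_apply (continuousAt_const (y := v))
  · filter_upwards [(chartAt E x₀).open_source.mem_nhds (mem_chart_source E _)] with x hx X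
    rw [mem_isotropyAlgebra]
    have e : (infinitesimalAction EH H (E := E) x X : E) =
      modelDeriv EH E (fun h : H ↦ h • x) 1 X := infinitesimalAction_apply x X
    exact (map_eq_zero_iff (tangentCoord E M x x₀) (tangentCoord_injective hx)).trans
      (Eq.congr_left e.symm)

lemma exists_pullbackForm_smul (g : LorentzMetric E M) {h : H}
    (hg : g.IsConformal fun x : M ↦ h • x) (x : M) :
    ∃ c : ℝ, 0 < c ∧ ∀ X, pullbackForm EH H g (h • x) (Ad h X) = c * pullbackForm EH H g x X := by
  obtain ⟨c, -, hc, hg⟩ := hg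
  refine ⟨c x, hc x, fun X ↦ ?_⟩
  rw [pullbackForm_apply, pullbackForm_apply, ← hg, infinitesimalAction_smul]

/-- The vector field generated by `X` is a continuous section of the tangent bundle, and the metric
is evaluated on it twice. -/
lemma continuous_pullbackForm (g : LorentzMetric E M) (X : GroupLieAlgebra 𝓘(ℝ, EH) H) :
    Continuous fun x ↦ pullbackForm EH H g x X := by
  have : IsManifold 𝓘(ℝ, E) 1 M := IsManifold.of_le (n := ∞) (by simp)
  have hv : ContMDiff 𝓘(ℝ, E) 𝓘(ℝ, E).tangent 0 (fun x : M ↦ Bundle.TotalSpace.mk' E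
      (E := TangentSpace 𝓘(ℝ, E)) x (infinitesimalAction EH H (E := E) x X)) := by
    intro x₀
    let v : EH := X
    rw [Bundle.contMDiffAt_section]
    have h := (contMDiffAt_tangentCoord_comp_infinitesimalAction (E := E) (EH := EH) (H := H)
      x₀).clm_apply (contMDiffAt_const (c := v))
    refine h.congr_of_eventuallyEq (Filter.Eventually.of_forall fun x ↦ ?_)
    exact congrArg (tangentCoord E M x x₀) (infinitesimalAction_apply x X)
  have hg := g.contMDiff.of_le (m := 0) (by simp)
  have hgv := ContMDiff.clm_bundle_apply₂ (F₁ := E) (F₂ := E) (F₃ := ℝ)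
    (E₁ := TangentSpace 𝓘(ℝ, E)) (E₂ := TangentSpace 𝓘(ℝ, E)) (E₃ := Bundle.Trivial M ℝ)
    (b := id) (n := 0) (IB := 𝓘(ℝ, E)) (IM := 𝓘(ℝ, E)) (ψ := g.val)
    (v := fun x ↦ infinitesimalAction EH H (E := E) x X)
    (w := fun x ↦ infinitesimalAction EH H (E := E) x X) hg hv hv
  have : ContMDiff 𝓘(ℝ, E) 𝓘(ℝ, ℝ) 0 (fun x ↦ pullbackForm EH H g x X) := fun x ↦
    (Bundle.contMDiffAt_totalSpace.1 (hgv x)).2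
  exact this.continuous

end Action

/-! ### Asymptotics of leading coefficients -/

section LeadingCoefficients

open Filter Topology Finset

variable {ι : Type*} {l : Filter ι} {u : ι → ℝ}

lemma exists_top_ne_zero {Z : Type*} [Zero Z] (a : ℕ → Z) {n j : ℕ} (hj : j < n) (ha : a j ≠ 0) :
    ∃ m < n, a m ≠ 0 ∧ ∀ j, m < j → j < n → a j = 0 := by
  induction n with
  | zero => omega
  | succ n ih =>
    by_cases h : a n = 0
    · obtain ⟨m, hm, hm', hz⟩ := ih (by grind)
      exact ⟨m, by omega, hm', fun j h1 h2 ↦ by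
        rcases Nat.lt_succ_iff_lt_or_eq.1 h2 with h2 | rfl
        · exact hz j h1 h2
        · exact h⟩
    · exact ⟨n, by omega, h, fun j h1 h2 ↦ by omega⟩

/-- Lower terms die because `u ^ j / u ^ m → 0`; higher ones vanish identically. The coefficients
may vary with the index, which is needed when a moving linear map is applied to a polynomial curve.
-/
lemma tendsto_leading {Z : Type*} [NormedAddCommGroup Z] [NormedSpace ℝ Z]
    (hu : Tendsto u l atTop) {n m : ℕ} (hm : m < n) {a : ℕ → ι → Z} {a₀ : ℕ → Z}
    (ha : ∀ j, Tendsto (a j) l (𝓝 (a₀ j)))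
    (hz : ∀ j, m < j → j < n → ∀ i, a j i = 0) :
    Tendsto (fun i ↦ (u i ^ m)⁻¹ • ∑ j ∈ range n, u i ^ j • a j i) l (𝓝 (a₀ m)) := by
  have key : ∀ j ∈ range n, Tendsto (fun i ↦ (u i ^ j / u i ^ m) • a j i) l
      (𝓝 (if j = m then a₀ m else 0)) := by
    intro j hj
    rcases lt_trichotomy j m with h | rfl | h
    · rw [if_neg h.ne]
      simpa using ((tendsto_pow_div_pow_atTop_zero (𝕜 := ℝ) h).comp hu).smul (ha j)
    · rw [if_pos rfl]
      refine (ha j).congr' ?_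
      filter_upwards [hu.eventually_gt_atTop 0] with i hi
      rw [div_self (by positivity), one_smul]
    · rw [if_neg h.ne']
      simpa [hz j h (mem_range.1 hj)] using tendsto_const_nhds
  have := tendsto_finsetSum _ key
  rw [Finset.sum_ite_eq' (range n) m, if_pos (mem_range.2 hm)] at this
  refine this.congr fun i ↦ ?_
  rw [smul_sum]
  exact sum_congr rfl fun j _ ↦ by rw [smul_smul, div_eq_inv_mul]

/-- If two polynomials of degree at most `m` differ by a reparametrization that is asymptotic to
multiplication by `χ`, their coefficients of degree `m` differ by the factor `χ ^ m`. -/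
lemma coeff_eq_of_reparam {s : ℝ → ℝ} {χ : ℝ} (hχ : 0 < χ)
    (hs : Tendsto (fun u ↦ s u / u) atTop (𝓝 χ)) {n m : ℕ} (hm : m < n) {a b : ℕ → ℝ}
    (ha : ∀ j, m < j → j < n → a j = 0) (hb : ∀ j, m < j → j < n → b j = 0)
    (hab : ∀ᶠ u in atTop, ∑ j ∈ range n, u ^ j * b j = ∑ j ∈ range n, s u ^ j * a j) :
    b m = χ ^ m * a m := by
  have hs' : Tendsto s atTop atTop := by
    refine (hs.pos_mul_atTop hχ tendsto_id).congr' ?_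
    filter_upwards [eventually_gt_atTop 0] with u hu
    simp [div_mul_cancel₀ _ hu.ne']
  have h1 := tendsto_leading (tendsto_id (α := ℝ) (x := atTop)) hm (a := fun j _ ↦ b j)
    (fun j ↦ tendsto_const_nhds) (fun j h h' _ ↦ hb j h h')
  have h2 := tendsto_leading hs' hm (a := fun j _ ↦ a j)
    (fun j ↦ tendsto_const_nhds) (fun j h h' _ ↦ ha j h h')
  have h3 := (hs.pow m).mul h2
  refine tendsto_nhds_unique (h1.congr' ?_) h3
  filter_upwards [hab, eventually_gt_atTop 0, hs'.eventually_gt_atTop 0] with u h hu hsu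
  simp only [smul_eq_mul, id] at h ⊢
  rw [h, div_pow]
  field_simp

/-- A limit of multiples of polynomial functions whose parameter tends to infinity is a multiple of
the leading coefficient. -/
lemma exists_eq_smul_of_tendsto {X Z : Type*} [NormedAddCommGroup Z] [NormedSpace ℝ Z] [l.NeBot]
    (hu : Tendsto u l atTop) {n m : ℕ} (hm : m < n) {q : ℕ → X → ℝ} (hq : q m ≠ 0)
    (hz : ∀ j, m < j → j < n → q j = 0) {c : ι → Z} {L : X → Z}
    (hL : ∀ x, Tendsto (fun i ↦ (∑ j ∈ range n, u i ^ j * q j x) • c i) l (𝓝 (L x))) :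
    ∃ r : Z, ∀ x, L x = q m x • r := by
  have hp : ∀ x, Tendsto (fun i ↦ (u i ^ m)⁻¹ • ∑ j ∈ range n, u i ^ j * q j x) l
      (𝓝 (q m x)) := fun x ↦
    tendsto_leading hu hm (a := fun j _ ↦ q j x) (fun j ↦ tendsto_const_nhds)
      (fun j h h' _ ↦ by simp [hz j h h'])
  obtain ⟨x₀, hx₀⟩ := Function.ne_iff.1 hq
  -- The scalars `c i` are not assumed to converge; testing at a point where `q m` is nonzero shows
  -- that `u i ^ m • c i` does.
  have hc : Tendsto (fun i ↦ u i ^ m • c i) l (𝓝 ((q m x₀)⁻¹ • L x₀)) := by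
    refine (((hp x₀).inv₀ hx₀).smul (hL x₀)).congr' ?_
    filter_upwards [hu.eventually_gt_atTop 0, (hp x₀).eventually_ne hx₀] with i hi hi'
    simp only [smul_eq_mul] at hi'
    have := right_ne_zero_of_mul hi'
    rw [smul_smul, smul_eq_mul]
    congr 1
    field_simp
  refine ⟨_, fun x ↦ tendsto_nhds_unique (hL x) (((hp x).smul hc).congr' ?_)⟩
  filter_upwards [hu.eventually_gt_atTop 0] with i hi
  rw [smul_smul]
  congr 1
  simp only [smul_eq_mul]
  field_simp

end LeadingCoefficients

/-! ### Limits under polynomial curves of endomorphisms -/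

section Dynamics

open Filter Topology Finset

variable {V : Type*} [AddCommGroup V] [Module ℝ V]

/-- The polynomial curve of endomorphisms with coefficients `D 0`, `D 1`, `D 2`. -/
def quadraticCurve (D : ℕ → V →ₗ[ℝ] V) (u : ℝ) : V →ₗ[ℝ] V := ∑ j ∈ range 3, u ^ j • D j

lemma quadraticCurve_apply (D : ℕ → V →ₗ[ℝ] V) (u : ℝ) (X : V) :
    quadraticCurve D u X = ∑ j ∈ range 3, u ^ j • D j X := by
  simp [quadraticCurve]

/-- The endomorphism `R` commutes with the curve, and composing with it amounts asymptotically
to rescaling the parameter by `χ`. -/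
structure IsReparam (D : ℕ → V →ₗ[ℝ] V) (R : V →ₗ[ℝ] V) (χ : ℝ) : Prop where
  pos : 0 < χ
  exists_reparam : ∃ s : ℝ → ℝ, Tendsto (fun u ↦ s u / u) atTop (𝓝 χ) ∧
    ∀ᶠ u in atTop, ∀ X, quadraticCurve D u (R X) = quadraticCurve D (s u) X ∧
      R (quadraticCurve D u X) = quadraticCurve D (s u) X

variable {M : Type*} [TopologicalSpace M]

/-- A family of subspaces that are locally the kernels of linear maps into `E` depending
continuously on the point. -/
def IsKernelFamily (E : Type*) [NormedAddCommGroup E] [NormedSpace ℝ E]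
    (k : M → Submodule ℝ V) : Prop :=
  ∀ x₀, ∃ A : M → V →ₗ[ℝ] E, (∀ X, ContinuousAt (fun x ↦ A x X) x₀) ∧
    ∀ᶠ x in 𝓝 x₀, ∀ X, A x X = 0 ↔ X ∈ k x

variable {E : Type*} [NormedAddCommGroup E] [NormedSpace ℝ E] {k : M → Submodule ℝ V}
  {D : ℕ → V →ₗ[ℝ] V} {F : Set M}

/-- If `A x₀ X ≠ 0`, this persists near `x₀`: kernels can only grow in a limit. -/
lemma IsKernelFamily.isClosed (hk : IsKernelFamily E k) (X : V) : IsClosed {x | X ∈ k x} := by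
  rw [← isOpen_compl_iff, isOpen_iff_mem_nhds]
  intro x₀ hx₀
  obtain ⟨A, hA, hA'⟩ := hk x₀
  have h0 : A x₀ X ≠ 0 := fun h ↦ hx₀ ((hA'.self_of_nhds X).1 h)
  filter_upwards [(hA X).eventually_ne h0, hA'] with x h h' hx
  exact h ((h' X).2 hx)

lemma IsKernelFamily.isClosed_le (hk : IsKernelFamily E k) (W : Submodule ℝ V) :
    IsClosed {x | W ≤ k x} := by
  have : {x | W ≤ k x} = ⋂ X ∈ W, {x | X ∈ k x} := by ext; simp [SetLike.le_def]
  rw [this]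
  exact isClosed_biInter fun X _ ↦ hk.isClosed X

/-- A sequence in a compact set has a limit along the hyperfilter. -/
lemma exists_tendsto_hyperfilter (hF : IsCompact F) (y : ℕ → M) (hy : ∀ i, y i ∈ F) :
    ∃ z ∈ F, Tendsto y (hyperfilter ℕ : Filter ℕ) (𝓝 z) := by
  obtain ⟨z, hz, hle⟩ := hF.ultrafilter_le_nhds ((hyperfilter ℕ).map y)
    (by rw [le_principal_iff]; exact Eventually.of_forall (f := ((hyperfilter ℕ : Filter ℕ))) hy)
  exact ⟨z, hz, hle⟩

lemma tendsto_hyperfilter {u : ℕ → ℝ} (hu : Tendsto u atTop atTop) :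
    Tendsto u (hyperfilter ℕ : Filter ℕ) atTop :=
  hu.mono_left Nat.hyperfilter_le_atTop

/-- Composing with `R` on the left reparametrizes the curve, so after applying any functional the
coefficients of degree `m` can be compared. The leading vector is thus an eigenvector of `R`. -/
lemma IsReparam.map_top {R : V →ₗ[ℝ] V} {χ : ℝ} (hR : IsReparam D R χ) [FiniteDimensional ℝ V]
    {v : V} {m : ℕ} (hm : m < 3) (hz : ∀ j, m < j → j < 3 → D j v = 0) :
    R (D m v) = χ ^ m • D m v := by
  rw [← sub_eq_zero, ← Module.forall_dual_apply_eq_zero_iff ℝ]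
  intro φ
  obtain ⟨s, hs, hs'⟩ := hR.exists_reparam
  have := coeff_eq_of_reparam hR.pos hs hm (a := fun j ↦ φ (D j v)) (b := fun j ↦ φ (R (D j v)))
    (fun j h h' ↦ by simp [hz j h h']) (fun j h h' ↦ by simp [hz j h h']) (by
      filter_upwards [hs'] with u hu
      have := congrArg φ (hu v).2
      simpa [quadraticCurve_apply] using this)
  simp [this]

/-- The same comparison with `R` composed on the right. Leaving `f` arbitrary covers both quadratic
forms (`n = 5`) and linear functionals (`n = 3`). -/
lemma IsReparam.form_top {R : V →ₗ[ℝ] V} {χ : ℝ} (hR : IsReparam D R χ)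
    {f : V → ℝ} {n m : ℕ} (hm : m < n) {q : ℕ → V → ℝ}
    (hq : ∀ u X, f (quadraticCurve D u X) = ∑ j ∈ range n, u ^ j * q j X)
    (hz : ∀ j, m < j → j < n → q j = 0) (X : V) :
    q m (R X) = χ ^ m * q m X := by
  obtain ⟨s, hs, hs'⟩ := hR.exists_reparam
  refine coeff_eq_of_reparam hR.pos hs hm (a := fun j ↦ q j X) (b := fun j ↦ q j (R X))
    (fun j h h' ↦ by simp [hz j h h']) (fun j h h' ↦ by simp [hz j h h']) ?_
  filter_upwards [hs'] with u hu
  rw [← hq, ← hq, (hu X).1]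

lemma exists_form_expansion (Q : QuadraticForm ℝ V) (D : ℕ → V →ₗ[ℝ] V) :
    ∃ q : ℕ → V → ℝ, ∀ u X, Q (quadraticCurve D u X) = ∑ j ∈ range 5, u ^ j * q j X := by
  refine ⟨fun j X ↦ match j with
    | 0 => Q (D 0 X)
    | 1 => QuadraticMap.polar Q (D 0 X) (D 1 X)
    | 2 => Q (D 1 X) + QuadraticMap.polar Q (D 0 X) (D 2 X)
    | 3 => QuadraticMap.polar Q (D 1 X) (D 2 X)
    | _ => Q (D 2 X), fun u X ↦ ?_⟩
  rw [quadraticCurve_apply]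
  simp only [sum_range_succ, range_zero, sum_empty, pow_zero, pow_one, one_smul, zero_add]
  rw [QuadraticMap.map_add Q, QuadraticMap.map_add Q, QuadraticMap.polar_add_left,
    QuadraticMap.polar_smul_right, QuadraticMap.polar_smul_left, QuadraticMap.polar_smul_right,
    QuadraticMap.polar_smul_right, QuadraticMap.map_smul, QuadraticMap.map_smul]
  simp only [smul_eq_mul]
  ring

/-- A family of quadratic forms that is equivariant up to scalars under a polynomial curve of
endomorphisms has a member in each compact invariant set that is invariant up to scalars under
all reparametrizations. -/
lemma exists_form_invariant (Q : M → QuadraticForm ℝ V) (hQ : ∀ X, Continuous fun x ↦ Q x X)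
    (hF : IsCompact F) (hF' : F.Nonempty) {u : ℕ → ℝ} (hu : Tendsto u atTop atTop)
    (hb : ∀ x ∈ F, ∀ i, ∃ y ∈ F, ∃ c : ℝ, ∀ X, Q y X = c * Q x (quadraticCurve D (u i) X)) :
    ∃ y ∈ F, ∃ m : ℕ, ∀ R χ, IsReparam D R χ → ∀ X, Q y (R X) = χ ^ m * Q y X := by
  obtain ⟨x, hx⟩ := hF'
  choose y hy c hc using hb x hx
  obtain ⟨z, hz, hyz⟩ := exists_tendsto_hyperfilter hF y hy
  obtain ⟨q, hq⟩ := exists_form_expansion (Q x) D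
  have hlim : ∀ X, Tendsto (fun i ↦ (∑ j ∈ range 5, u i ^ j * q j X) • c i)
      (hyperfilter ℕ : Filter ℕ) (𝓝 (Q z X)) := fun X ↦ by
    refine (((hQ X).tendsto z).comp hyz).congr fun i ↦ ?_
    rw [Function.comp_apply, hc, hq, smul_eq_mul, mul_comm]
  refine ⟨z, hz, ?_⟩
  by_cases h : ∃ j < 5, q j ≠ 0
  · obtain ⟨j, hj, hj'⟩ := h
    obtain ⟨m, hm, hm', hmz⟩ := exists_top_ne_zero q hj hj'
    obtain ⟨r, hr⟩ := exists_eq_smul_of_tendsto (tendsto_hyperfilter hu) hm hm' hmz hlim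
    refine ⟨m, fun R χ hR X ↦ ?_⟩
    rw [hr, hr, hR.form_top hm hq hmz]
    simp only [smul_eq_mul]; ring
  · push Not at h
    have h0 : ∀ X, Q z X = 0 := fun X ↦ by
      refine tendsto_nhds_unique (hlim X) ?_
      have : ∀ i, ∑ j ∈ range 5, u i ^ j * q j X = 0 := fun i ↦
        sum_eq_zero fun j hj ↦ by simp [h j (mem_range.1 hj)]
      simp [this]
    -- The limit form is zero, so every exponent works.
    exact ⟨0, fun R χ _ X ↦ by simp [h0]⟩

/-- In each compact set that is invariant under a polynomial curve of endomorphisms, a member of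
maximal dimension of an equivariant family of subspaces can be chosen to be invariant under all
reparametrizations. -/
lemma exists_kernel_invariant (hV : Module.finrank ℝ V = 3) (hk : IsKernelFamily E k)
    (hF : IsCompact F) (hF' : F.Nonempty) {u : ℕ → ℝ} (hu : Tendsto u atTop atTop)
    (hinj : ∀ i, Function.Injective (quadraticCurve D (u i)))
    (hb : ∀ x ∈ F, ∀ i, ∃ y ∈ F, ∀ X ∈ k x, quadraticCurve D (u i) X ∈ k y)
    (hb' : ∀ x ∈ F, ∀ i, ∃ y ∈ F, ∀ X, X ∈ k y ↔ quadraticCurve D (u i) X ∈ k x) :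
    ∃ y ∈ F, (∀ x ∈ F, Module.finrank ℝ (k x) ≤ Module.finrank ℝ (k y)) ∧
      ∀ R χ, IsReparam D R χ → ∀ X ∈ k y, R X ∈ k y := by
  have : FiniteDimensional ℝ V := Module.finite_of_finrank_pos (by omega)
  obtain ⟨x, hx, hmax⟩ : ∃ x ∈ F, ∀ z ∈ F, Module.finrank ℝ (k z) ≤ Module.finrank ℝ (k x) := by
    have hbdd : BddAbove ((fun z ↦ Module.finrank ℝ (k z)) '' F) :=
      ⟨3, by rintro _ ⟨z, -, rfl⟩; exact hV ▸ Submodule.finrank_le _⟩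
    obtain ⟨x, hx, hx'⟩ := Nat.sSup_mem (hF'.image fun z ↦ Module.finrank ℝ (k z)) hbdd
    refine ⟨x, hx, fun z hz ↦ ?_⟩
    refine le_trans ?_ hx'.ge
    exact le_csSup hbdd ⟨z, hz, rfl⟩
  -- By maximality of the dimension, an invariant `W` of that dimension inside `k y` is all of `k
  -- y`.
  suffices h : ∃ y ∈ F, ∃ W ≤ k y, Module.finrank ℝ W = Module.finrank ℝ (k x) ∧
      ∀ R χ, IsReparam D R χ → ∀ X ∈ W, R X ∈ W by
    obtain ⟨y, hy, W, hW, hW', hR⟩ := h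
    have : W = k y := Submodule.eq_of_le_of_finrank_le hW (hW' ▸ hmax y hy)
    subst this
    exact ⟨y, hy, fun z hz ↦ hW' ▸ hmax z hz, hR⟩
  have hd : Module.finrank ℝ (k x) ≤ 3 := hV ▸ Submodule.finrank_le _
  obtain h | h | h | h : Module.finrank ℝ (k x) = 0 ∨ Module.finrank ℝ (k x) = 1 ∨
      Module.finrank ℝ (k x) = 2 ∨ Module.finrank ℝ (k x) = 3 := by omega
  · refine ⟨x, hx, k x, le_rfl, rfl, fun R χ _ X hX ↦ ?_⟩
    rw [Submodule.finrank_eq_zero] at h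
    simp_all
  -- A line is followed forward: `D(u i) v` lies in `k (y i)`, and its direction tends to that of
  -- the leading coefficient `D m v`.
  · obtain ⟨v, hv, hv0⟩ := Submodule.exists_mem_ne_zero_of_ne_bot (p := k x)
      (by rintro h0; rw [h0, finrank_bot] at h; omega)
    choose y hy hc using hb x hx
    obtain ⟨z, hz, hyz⟩ := exists_tendsto_hyperfilter hF y hy
    obtain ⟨A, hA, hA'⟩ := hk z
    have hne : ∃ j < 3, D j v ≠ 0 := by
      by_contra! hcon
      refine hv0 (hinj 0 ?_)
      rw [map_zero, quadraticCurve_apply]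
      exact sum_eq_zero fun j hj ↦ by simp [hcon j (mem_range.1 hj)]
    obtain ⟨j, hj, hj'⟩ := hne
    obtain ⟨m, hm, hm', hmz⟩ := exists_top_ne_zero (fun j ↦ D j v) hj hj'
    refine ⟨z, hz, Submodule.span ℝ {D m v}, ?_, ?_, ?_⟩
    · rw [Submodule.span_singleton_le_iff_mem, ← hA'.self_of_nhds]
      have h1 := tendsto_leading (tendsto_hyperfilter hu) hm
        (a := fun j i ↦ A (y i) (D j v)) (a₀ := fun j ↦ A z (D j v))
        (fun j ↦ (hA _).tendsto.comp hyz) (fun j h h' i ↦ by simp [hmz j h h'])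
      refine tendsto_nhds_unique h1 (tendsto_const_nhds.congr' ?_)
      filter_upwards [hyz.eventually hA'] with i hi
      have := (hi _).2 (hc i _ hv)
      rw [quadraticCurve_apply] at this
      simp only [map_sum, map_smul] at this
      simp [this]
    · rw [finrank_span_singleton hm', h]
    · intro R χ hR X hX
      obtain ⟨a, rfl⟩ := Submodule.mem_span_singleton.1 hX
      rw [map_smul, hR.map_top hm hmz]
      exact Submodule.smul_mem _ _ (Submodule.smul_mem _ _ (Submodule.mem_span_singleton_self _))
  -- A plane is treated dually, as the kernel of a functional pulled back along the curve; the limit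
  -- contains the kernel of the leading coefficient of `ℓ ∘ D(u)`.
  · obtain ⟨ℓ, hℓ⟩ : ∃ ℓ : V →ₗ[ℝ] ℝ, LinearMap.ker ℓ = k x := by
      have h1 : Module.finrank ℝ (V ⧸ k x) = 1 := by
        have := (k x).finrank_quotient_add_finrank; omega
      let e := LinearEquiv.ofFinrankEq (R := ℝ) (V ⧸ k x) ℝ (by simpa using h1)
      exact ⟨e.toLinearMap ∘ₗ (k x).mkQ, by simp [LinearMap.ker_comp]⟩
    have hℓ' : ∀ X, ℓ X = 0 ↔ X ∈ k x := fun X ↦ by rw [← hℓ, LinearMap.mem_ker]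
    have hsurj : ∀ i, Function.Surjective (quadraticCurve D (u i)) := fun i ↦
      LinearMap.injective_iff_surjective.1 (hinj i)
    have hX₀ : ∃ X₀, ℓ X₀ ≠ 0 := by
      by_contra! hcon
      have : k x = ⊤ := by ext X; simp [← hℓ', hcon]
      rw [this, finrank_top] at h; omega
    obtain ⟨X₀, hX₀⟩ := hX₀
    choose y hy hc using hb' x hx
    obtain ⟨z, hz, hyz⟩ := exists_tendsto_hyperfilter hF y hy
    obtain ⟨A, hA, hA'⟩ := hk z
    let q : ℕ → V → ℝ := fun j X ↦ ℓ (D j X)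
    have hq : ∀ u X, ℓ (quadraticCurve D u X) = ∑ j ∈ range 3, u ^ j * q j X := fun u X ↦ by
      simp [quadraticCurve_apply, q]
    have hne : ∃ j < 3, q j ≠ 0 := by
      by_contra! hcon
      obtain ⟨X₁, hX₁⟩ := hsurj 0 X₀
      refine hX₀ ?_
      rw [← hX₁, hq]
      exact sum_eq_zero fun j hj ↦ by simp [hcon j (mem_range.1 hj)]
    obtain ⟨j, hj, hj'⟩ := hne
    obtain ⟨m, hm, hm', hmz⟩ := exists_top_ne_zero q hj hj'
    -- Normalizing `ℓ (D(u i) (Y i)) = 1` puts `X - ℓ (D(u i) X) • Y i` in `k (y i)`. Hence `A (y i)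
    -- X` is a scalar polynomial times the fixed vector `A (y i) (Y i)`, as
    -- `exists_eq_smul_of_tendsto` requires.
    choose Y hY using fun i ↦ hsurj i ((ℓ X₀)⁻¹ • X₀)
    have hYℓ : ∀ i, ℓ (quadraticCurve D (u i) (Y i)) = 1 := fun i ↦ by
      rw [hY, map_smul, smul_eq_mul, inv_mul_cancel₀ hX₀]
    obtain ⟨r, hr⟩ := exists_eq_smul_of_tendsto (tendsto_hyperfilter hu) hm hm' hmz
      (c := fun i ↦ A (y i) (Y i)) (L := fun X ↦ A z X) (fun X ↦ by
        refine ((hA X).tendsto.comp hyz).congr' ?_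
        filter_upwards [hyz.eventually hA'] with i hi
        have : X - ℓ (quadraticCurve D (u i) X) • Y i ∈ k (y i) := by
          rw [hc, ← hℓ', map_sub, map_smul, map_sub, map_smul, hYℓ, smul_eq_mul, mul_one, sub_self]
        rw [← hi, map_sub, map_smul, sub_eq_zero] at this
        rw [← hq, Function.comp_apply, this])
    refine ⟨z, hz, LinearMap.ker (ℓ ∘ₗ D m), fun X hX ↦ ?_, ?_, ?_⟩
    · rw [← hA'.self_of_nhds, hr, show q m X = 0 from hX, zero_smul]
    · have h1 : ℓ ∘ₗ D m ≠ 0 := fun h ↦ hm' (by ext X; exact LinearMap.congr_fun h X)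
      have h2 := Module.Dual.finrank_ker_add_one_of_ne_zero h1
      omega
    · intro R χ hR X hX
      have := hR.form_top hm hq hmz X
      rw [LinearMap.mem_ker] at hX ⊢
      exact this.trans (by rw [show q m X = 0 from hX, mul_zero])
  · refine ⟨x, hx, k x, le_rfl, rfl, fun R χ _ X hX ↦ ?_⟩
    rw [Submodule.eq_top_of_finrank_eq (h.trans hV.symm)]
    trivial

end Dynamics

/-! ### The Borel group and its one-parameter subgroups -/

section Borel

open Filter Topology Finset

variable {V : Type*} [AddCommGroup V] [Module ℝ V] (b : Module.Basis (Fin 3) ℝ V)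

/-- The endomorphism with parameters `a`, `t` in the Borel group attached to the basis `b`. -/
def borel (a t : ℝ) : V →ₗ[ℝ] V :=
  b.constr ℝ ![a • b 0, b 1 + t • b 0, a⁻¹ • b 2 - (t / (2 * a)) • b 1 - (t ^ 2 / (4 * a)) • b 0]

lemma borel_zero (a t : ℝ) : borel b a t (b 0) = a • b 0 := by simp [borel]
lemma borel_one (a t : ℝ) : borel b a t (b 1) = b 1 + t • b 0 := by simp [borel]
lemma borel_two (a t : ℝ) : borel b a t (b 2) =
    a⁻¹ • b 2 - (t / (2 * a)) • b 1 - (t ^ 2 / (4 * a)) • b 0 := by simp [borel]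

variable {b}

lemma linearMap_ext_three {W : Type*} [AddCommGroup W] [Module ℝ W] {f g : V →ₗ[ℝ] W}
    (h0 : f (b 0) = g (b 0)) (h1 : f (b 1) = g (b 1)) (h2 : f (b 2) = g (b 2)) : f = g :=
  b.ext fun i ↦ by fin_cases i <;> assumption

lemma exists_eq_combination (X : V) : ∃ x y z : ℝ, X = x • b 0 + y • b 1 + z • b 2 :=
  ⟨b.repr X 0, b.repr X 1, b.repr X 2, by
    rw [← Fin.sum_univ_three (fun i ↦ b.repr X i • b i), b.sum_repr]⟩

lemma combination_inj {x y z x' y' z' : ℝ}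
    (h : x • b 0 + y • b 1 + z • b 2 = x' • b 0 + y' • b 1 + z' • b 2) :
    x = x' ∧ y = y' ∧ z = z' := by
  have h0 := congrArg (fun X ↦ b.repr X 0) h
  have h1 := congrArg (fun X ↦ b.repr X 1) h
  have h2 := congrArg (fun X ↦ b.repr X 2) h
  simp at h0 h1 h2
  exact ⟨h0, h1, h2⟩

lemma borel_one_zero_eq_id : borel b 1 0 = LinearMap.id := by
  refine linearMap_ext_three (b := b) ?_ ?_ ?_ <;> simp [borel_zero, borel_one, borel_two]

lemma borel_comp {a a' : ℝ} (ha : a ≠ 0) (ha' : a' ≠ 0) (t t' : ℝ) :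
    borel b a t ∘ₗ borel b a' t' = borel b (a * a') (t + a * t') := by
  refine linearMap_ext_three (b := b) ?_ ?_ ?_ <;>
    simp only [LinearMap.comp_apply, borel_zero, borel_one, borel_two, map_add, map_sub, map_smul]
  · module
  · module
  · match_scalars <;> field_simp <;> ring

lemma borel_inj {a a' t t' : ℝ} (h : borel b a t = borel b a' t') : a = a' ∧ t = t' := by
  have h0 := LinearMap.congr_fun h (b 0)
  have h1 := LinearMap.congr_fun h (b 1)
  rw [borel_zero, borel_zero] at h0
  rw [borel_one, borel_one] at h1
  constructor
  · exact (combination_inj (b := b) (y := 0) (z := 0) (y' := 0) (z' := 0) (by simpa using h0)).1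
  · exact (combination_inj (b := b) (y := 1) (z := 0) (y' := 1) (z' := 0) (by
      simpa [add_comm] using h1)).1

lemma borel_map (e : V ≃ₗ[ℝ] V) (a t : ℝ) :
    borel (b.map e) a t = e.toLinearMap ∘ₗ borel b a t ∘ₗ e.symm.toLinearMap := by
  refine linearMap_ext_three (b := b.map e) ?_ ?_ ?_ <;>
    simp [borel_zero, borel_one, borel_two, -Module.Basis.map_apply] <;>
    simp [borel_zero, borel_one, borel_two]

variable (b) in
/-- The linear equivalence given by a unipotent element of the Borel group. -/
def unipotentEquiv (t : ℝ) : V ≃ₗ[ℝ] V :=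
  LinearEquiv.ofLinearMap (borel b 1 t) (borel b 1 (-t))
    (by rw [borel_comp one_ne_zero one_ne_zero]; simp [borel_one_zero_eq_id])
    (by rw [borel_comp one_ne_zero one_ne_zero]; simp [borel_one_zero_eq_id])

/-- Conjugation by a unipotent element shifts `t` by a multiple of `a - 1`, so an element with `a ≠
1` can be made diagonal by a change of basis. -/
lemma borel_map_unipotentEquiv {a : ℝ} (ha : a ≠ 0) (t r : ℝ) :
    borel (b.map (unipotentEquiv b r)) a (t + (a - 1) * r) = borel b a t := by
  rw [borel_map]
  change borel b 1 r ∘ₗ borel b a _ ∘ₗ borel b 1 (-r) = _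
  rw [borel_comp ha one_ne_zero, borel_comp one_ne_zero (by simpa using ha)]
  congr 1 <;> ring

variable (b) in
/-- The coefficients of the unipotent one-parameter group. -/
def unipotentCoeff : ℕ → V →ₗ[ℝ] V
  | 0 => LinearMap.id
  | 1 => b.constr ℝ ![0, b 0, -(1 / 2 : ℝ) • b 1]
  | _ => b.constr ℝ ![0, 0, -(1 / 4 : ℝ) • b 0]

variable (b) in
/-- The coefficients of the (rescaled) diagonal one-parameter group. -/
def diagonalCoeff : ℕ → V →ₗ[ℝ] V
  | 0 => b.constr ℝ ![0, 0, b 2]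
  | 1 => b.constr ℝ ![0, b 1, 0]
  | _ => b.constr ℝ ![b 0, 0, 0]

lemma quadraticCurve_unipotentCoeff (u : ℝ) :
    quadraticCurve (unipotentCoeff b) u = borel b 1 u := by
  refine linearMap_ext_three (b := b) ?_ ?_ ?_ <;>
    simp [quadraticCurve_apply, sum_range_succ, unipotentCoeff, borel_zero, borel_one, borel_two]
  module

/-- The weights `u, 1, u⁻¹` become `u ^ 2, u, 1` after multiplication by `u`. This makes the curve
polynomial and is harmless for statements up to scale. -/
lemma quadraticCurve_diagonalCoeff {u : ℝ} (hu : u ≠ 0) :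
    quadraticCurve (diagonalCoeff b) u = u • borel b u 0 := by
  refine linearMap_ext_three (b := b) ?_ ?_ ?_ <;>
    simp [quadraticCurve_apply, sum_range_succ, diagonalCoeff, borel_zero, borel_one, borel_two,
      smul_smul, hu, pow_two]

/-- The reparametrization is the translation `u ↦ u + v`, asymptotic to the identity; hence `χ = 1`
and forms become strictly invariant. -/
lemma isReparam_unipotent (v : ℝ) : IsReparam (unipotentCoeff b) (borel b 1 v) 1 where
  pos := one_pos
  exists_reparam := by
    refine ⟨fun u ↦ u + v, ?_, Eventually.of_forall fun u X ↦ ?_⟩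
    · have : Tendsto (fun u : ℝ ↦ 1 + v * u⁻¹) atTop (𝓝 (1 + v * 0)) :=
        tendsto_const_nhds.add (tendsto_inv_atTop_zero.const_mul v)
      rw [mul_zero, add_zero] at this
      refine this.congr' ?_
      filter_upwards [eventually_gt_atTop 0] with u hu
      field_simp
    · simp only [quadraticCurve_unipotentCoeff, ← LinearMap.comp_apply,
        borel_comp one_ne_zero one_ne_zero, one_mul]
      exact ⟨trivial, by rw [add_comm]⟩

lemma isReparam_diagonal {v : ℝ} (hv : 0 < v) :
    IsReparam (diagonalCoeff b) (v • borel b v 0) v where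
  pos := hv
  exists_reparam := by
    refine ⟨fun u ↦ u * v, ?_, ?_⟩
    · refine tendsto_const_nhds.congr' ?_
      filter_upwards [eventually_gt_atTop 0] with u hu
      field_simp
    · filter_upwards [eventually_gt_atTop 0] with u hu X
      rw [quadraticCurve_diagonalCoeff hu.ne', quadraticCurve_diagonalCoeff (by positivity)]
      have h1 := LinearMap.congr_fun (borel_comp (b := b) hu.ne' hv.ne' 0 0) X
      have h2 := LinearMap.congr_fun (borel_comp (b := b) hv.ne' hu.ne' 0 0) X
      simp only [LinearMap.comp_apply, mul_zero, add_zero] at h1 h2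
      simp only [LinearMap.smul_apply, map_smul, h1, h2, smul_smul]
      exact ⟨by rw [mul_comm v u], by rw [mul_comm v u]⟩

/-- A subspace that is invariant under the unipotent group is invariant under the Borel group. -/
lemma borel_mem_of_unipotent_mem {W : Submodule ℝ V} (hW : ∀ v, ∀ X ∈ W, borel b 1 v X ∈ W)
    (a t : ℝ) {X : V} (hX : X ∈ W) : borel b a t X ∈ W := by
  obtain ⟨x, y, z, rfl⟩ := exists_eq_combination (b := b) X
  have h1 := W.sub_mem (hW 1 _ hX) hX
  -- The sum and the difference of `h1` and `h2` isolate the terms of `borel b 1 t X` of degree two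
  -- and one in `t`. They show that `W` is a member of the flag spanned successively by `b 0`, `b
  -- 1`, `b 2`.
  have h2 := W.sub_mem (hW (-1) _ hX) hX
  have h3 : -(z / 2) • b 0 ∈ W := by
    convert W.add_mem h1 h2 using 1
    simp only [map_add, map_smul, borel_zero, borel_one, borel_two]
    match_scalars <;> ring
  have h4 : (2 * y) • b 0 - z • b 1 ∈ W := by
    convert W.sub_mem h1 h2 using 1
    simp only [map_add, map_smul, borel_zero, borel_one, borel_two]
    match_scalars <;> ring
  by_cases hz : z = 0
  · subst hz
    by_cases hy : y = 0
    · subst hy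
      simp only [zero_smul, add_zero, map_smul, borel_zero] at hX ⊢
      rw [smul_comm]
      exact W.smul_mem _ hX
    · have h0 : b 0 ∈ W := by
        rw [zero_smul, sub_zero] at h4
        exact (W.smul_mem_iff (by positivity)).1 h4
      convert W.add_mem hX (W.smul_mem (x * (a - 1) + y * t) h0) using 1
      simp only [map_add, map_smul, borel_zero, borel_one, borel_two]
      match_scalars <;> ring
  · have h0 : b 0 ∈ W := (W.smul_mem_iff (by simpa using hz)).1 h3
    have h5 : b 1 ∈ W := by
      refine (W.smul_mem_iff hz).1 ?_
      convert W.sub_mem (W.smul_mem (2 * y) h0) h4 using 1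
      module
    have h6 : b 2 ∈ W := by
      refine (W.smul_mem_iff hz).1 ?_
      convert W.sub_mem hX (W.add_mem (W.smul_mem x h0) (W.smul_mem y h5)) using 1
      module
    have : ∀ X, X ∈ W := fun X ↦ by
      obtain ⟨x, y, z, rfl⟩ := exists_eq_combination (b := b) X
      exact W.add_mem (W.add_mem (W.smul_mem _ h0) (W.smul_mem _ h5)) (W.smul_mem _ h6)
    exact this _

end Borel

/-! ### Fixed points of a Borel group in an equivariant family -/

section EquivariantFamilies

open Filter Topology

variable {V : Type*} [AddCommGroup V] [Module ℝ V] {M : Type*} [TopologicalSpace M]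
  {Γ : Type*} [Group Γ] [MulAction Γ M]

/-- A family of subspaces and quadratic forms on `V` parametrized by `M`, equivariant (up to
positive scalars for the forms) under a representation of `Γ`. -/
structure IsEquivariantFamily (ρ : Γ →* Module.End ℝ V) (k : M → Submodule ℝ V)
    (Q : M → QuadraticForm ℝ V) : Prop where
  mem_iff : ∀ s x X, ρ s X ∈ k (s • x) ↔ X ∈ k x
  form_eq : ∀ s x, ∃ c : ℝ, 0 < c ∧ ∀ X, Q (s • x) (ρ s X) = c * Q x X
  continuous_form : ∀ X, Continuous fun x ↦ Q x X

variable {ρ : Γ →* Module.End ℝ V} {k : M → Submodule ℝ V} {Q : M → QuadraticForm ℝ V}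
  {F : Set M} {D : ℕ → V →ₗ[ℝ] V} {b : Module.Basis (Fin 3) ℝ V}

lemma rep_inv_apply (s : Γ) (X : V) : ρ s⁻¹ (ρ s X) = X := by
  rw [← Module.End.mul_apply, ← map_mul, inv_mul_cancel, map_one, Module.End.one_apply]

lemma rep_apply_inv (s : Γ) (X : V) : ρ s (ρ s⁻¹ X) = X := by
  rw [← Module.End.mul_apply, ← map_mul, mul_inv_cancel, map_one, Module.End.one_apply]

/-- The form at `(c ^ i)⁻¹ • x` is a multiple of the form at `x` composed with `ρ (c ^ i)`. Only
powers of one element are used, yet the invariance holds for all reparametrizations. -/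
lemma IsEquivariantFamily.exists_form_invariant (h : IsEquivariantFamily ρ k Q)
    (hF : IsCompact F) (hF' : F.Nonempty) (hinv : ∀ s : Γ, ∀ x ∈ F, s • x ∈ F)
    {u a : ℕ → ℝ} (hu : Tendsto u atTop atTop) (ha : ∀ i, a i ≠ 0) {c : Γ}
    (hc : ∀ i, quadraticCurve D (u i) = a i • ρ (c ^ i)) :
    ∃ y ∈ F, ∃ m : ℕ, ∀ R χ, IsReparam D R χ → ∀ X, Q y (R X) = χ ^ m * Q y X := by
  refine ConformalLorentz.exists_form_invariant Q h.continuous_form hF hF' hu fun x hx i ↦ ?_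
  refine ⟨(c ^ i)⁻¹ • x, hinv _ _ hx, ?_⟩
  obtain ⟨r, hr, h'⟩ := h.form_eq (c ^ i) ((c ^ i)⁻¹ • x)
  rw [smul_inv_smul] at h'
  refine ⟨(a i * a i * r)⁻¹, fun X ↦ ?_⟩
  rw [hc, LinearMap.smul_apply, QuadraticMap.map_smul, h']
  have := ha i
  simp only [smul_eq_mul]
  field_simp

/-- Stated with a fixed subspace `W` of maximal dimension: on `F` the equality `k x = W` amounts to
the closed condition `W ≤ k x`, so the form argument can be run on this compact locus. -/
lemma IsEquivariantFamily.exists_kernel_invariant (h : IsEquivariantFamily ρ k Q)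
    {E : Type*} [NormedAddCommGroup E] [NormedSpace ℝ E] (hk : IsKernelFamily E k)
    (hV : Module.finrank ℝ V = 3)
    (hF : IsCompact F) (hF' : F.Nonempty) (hinv : ∀ s : Γ, ∀ x ∈ F, s • x ∈ F)
    {u a : ℕ → ℝ} (hu : Tendsto u atTop atTop) (ha : ∀ i, a i ≠ 0) {c : Γ}
    (hc : ∀ i, quadraticCurve D (u i) = a i • ρ (c ^ i)) :
    ∃ W : Submodule ℝ V, (∃ y ∈ F, W ≤ k y) ∧ (∀ x ∈ F, W ≤ k x → k x = W) ∧
      ∀ R χ, IsReparam D R χ → ∀ X ∈ W, R X ∈ W := by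
  have : FiniteDimensional ℝ V := Module.finite_of_finrank_pos (by omega)
  obtain ⟨y, hy, hmax, hR⟩ := ConformalLorentz.exists_kernel_invariant hV hk hF hF' hu
    (fun i X Y hXY ↦ by
      rw [hc, LinearMap.smul_apply, LinearMap.smul_apply] at hXY
      rw [← rep_inv_apply (ρ := ρ) (c ^ i) X, smul_right_injective _ (ha i) hXY, rep_inv_apply])
    (fun x hx i ↦ ⟨c ^ i • x, hinv _ _ hx, fun X hX ↦ by
      rw [hc, LinearMap.smul_apply]
      exact Submodule.smul_mem _ _ ((h.mem_iff _ _ _).2 hX)⟩)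
    (fun x hx i ↦ ⟨(c ^ i)⁻¹ • x, hinv _ _ hx, fun X ↦ by
      rw [hc, LinearMap.smul_apply, Submodule.smul_mem_iff _ (ha i), ← h.mem_iff (c ^ i),
        smul_inv_smul]⟩)
  exact ⟨k y, ⟨y, hy, le_rfl⟩, fun x hx hle ↦
    (Submodule.eq_of_le_of_finrank_le hle (hmax x hx)).symm, hR⟩

/-- In general the second parameter of the power is `(1 + a + … + a ^ (i - 1)) t`; the condition
keeps the powers on the unipotent or the diagonal curve. -/
lemma borel_pow {s : Γ} {a t : ℝ} (ha : a ≠ 0) (hs : ρ s = borel b a t) (hat : a = 1 ∨ t = 0)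
    (i : ℕ) : ρ (s ^ i) = borel b (a ^ i) (i * t) := by
  induction i with
  | zero => simp [borel_one_zero_eq_id]; rfl
  | succ i ih =>
    rw [pow_succ, map_mul, ih, hs, Module.End.mul_eq_comp, borel_comp (pow_ne_zero _ ha) ha,
      pow_succ]
    congr 1
    rcases hat with rfl | rfl <;> simp; ring

lemma rep_inv_eq_borel {s : Γ} {a t : ℝ} (ha : a ≠ 0) (hs : ρ s = borel b a t) :
    ρ s⁻¹ = borel b a⁻¹ (-(t / a)) := by
  have h1 : borel b a⁻¹ (-(t / a)) ∘ₗ borel b a t = LinearMap.id := by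
    rw [borel_comp (inv_ne_zero ha) ha, ← borel_one_zero_eq_id (b := b)]
    congr 1 <;> field_simp; ring
  ext X
  rw [← rep_apply_inv (ρ := ρ) s X, rep_inv_apply, hs]
  exact (LinearMap.congr_fun h1 _).symm

/-- The points of `F` whose subspace is the unipotent-invariant subspace `W` and whose form
is invariant under the unipotent group. -/
def unipotentFixed (b : Module.Basis (Fin 3) ℝ V) (k : M → Submodule ℝ V)
    (Q : M → QuadraticForm ℝ V) (W : Submodule ℝ V) (F : Set M) : Set M :=
  F ∩ {x | W ≤ k x} ∩ {x | ∀ v X, Q x (borel b 1 v X) = Q x X}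

lemma IsEquivariantFamily.le_smul (h : IsEquivariantFamily ρ k Q) {W : Submodule ℝ V}
    (hW : ∀ s, ∀ X ∈ W, ρ s X ∈ W) (s : Γ) {x : M} (hx : W ≤ k x) : W ≤ k (s • x) := fun X hX ↦ by
  rw [← rep_apply_inv (ρ := ρ) s X, h.mem_iff]
  exact hx (hW _ _ hX)

/-- The unipotent group is normal in the Borel group: moving `borel b 1 v` past `ρ s` only replaces
`v` by `v / a`. -/
lemma IsEquivariantFamily.unipotentFixed_smul (h : IsEquivariantFamily ρ k Q)
    (hinv : ∀ s : Γ, ∀ x ∈ F, s • x ∈ F) {W : Submodule ℝ V} (hW : ∀ s, ∀ X ∈ W, ρ s X ∈ W)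
    (hρ : ∀ s, ∃ a t, 0 < a ∧ ρ s = borel b a t) (s : Γ) {x : M}
    (hx : x ∈ unipotentFixed b k Q W F) : s • x ∈ unipotentFixed b k Q W F := by
  obtain ⟨⟨hxF, hxW⟩, hxQ⟩ := hx
  refine ⟨⟨hinv s x hxF, h.le_smul hW s hxW⟩, fun v X ↦ ?_⟩
  obtain ⟨a, t, ha, hs⟩ := hρ s
  obtain ⟨c, -, hc⟩ := h.form_eq s x
  have h1 : borel b 1 v ∘ₗ ρ s = ρ s ∘ₗ borel b 1 (v / a) := by
    rw [hs, borel_comp one_ne_zero ha.ne', borel_comp ha.ne' one_ne_zero]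
    congr 1 <;> field_simp; ring
  have h2 := LinearMap.congr_fun h1 (ρ s⁻¹ X)
  simp only [LinearMap.comp_apply, rep_apply_inv] at h2
  rw [h2, hc, hxQ, ← hc, rep_apply_inv]

/-- If `Γ` contains a nontrivial unipotent element, then there is a nonempty set of points that are
fixed, in the projective sense, by the unipotent group. -/
lemma IsEquivariantFamily.exists_unipotentFixed (h : IsEquivariantFamily ρ k Q)
    {E : Type*} [NormedAddCommGroup E] [NormedSpace ℝ E] (hk : IsKernelFamily E k)
    (hF : IsCompact F) (hF' : F.Nonempty) (hinv : ∀ s : Γ, ∀ x ∈ F, s • x ∈ F)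
    (hρ : ∀ s, ∃ a t, 0 < a ∧ ρ s = borel b a t) {c : Γ} {t : ℝ} (ht : t ≠ 0)
    (hc : ρ c = borel b 1 t) :
    ∃ W : Submodule ℝ V, (∀ x ∈ F, W ≤ k x → k x = W) ∧ (∀ s, ∀ X ∈ W, ρ s X ∈ W) ∧
      (unipotentFixed b k Q W F).Nonempty := by
  wlog htpos : 0 < t generalizing c t
  · refine this (c := c⁻¹) (t := -t) (neg_ne_zero.2 ht) ?_
      (neg_pos.2 (lt_of_le_of_ne (not_lt.1 htpos) ht))
    rw [rep_inv_eq_borel one_ne_zero hc]; simp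
  have hu : Tendsto (fun i : ℕ ↦ (i : ℝ) * t) atTop atTop :=
    tendsto_natCast_atTop_atTop.atTop_mul_const htpos
  have hcu : ∀ i : ℕ, quadraticCurve (unipotentCoeff b) (i * t) = (1 : ℝ) • ρ (c ^ i) := fun i ↦ by
    rw [quadraticCurve_unipotentCoeff, borel_pow one_ne_zero hc (Or.inl rfl)]; simp
  have hV : Module.finrank ℝ V = 3 := by simp [Module.finrank_eq_card_basis b]
  obtain ⟨W, hWne, hWmax, hWR⟩ := h.exists_kernel_invariant hk hV hF hF' hinv hu
    (fun _ ↦ one_ne_zero) hcu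
  have hW : ∀ s, ∀ X ∈ W, ρ s X ∈ W := fun s X hX ↦ by
    obtain ⟨a, t, -, hs⟩ := hρ s
    rw [hs]
    exact borel_mem_of_unipotent_mem (fun v Y hY ↦ hWR _ _ (isReparam_unipotent v) Y hY) a t hX
  refine ⟨W, hWmax, hW, ?_⟩
  obtain ⟨y, hy, m, hm⟩ := h.exists_form_invariant (F := F ∩ {x | W ≤ k x})
    (hF.inter_right (hk.isClosed_le W)) (by obtain ⟨y, hy⟩ := hWne; exact ⟨y, hy⟩)
    (fun s x hx ↦ ⟨hinv s x hx.1, h.le_smul hW s hx.2⟩) hu (fun _ ↦ one_ne_zero) hcu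
  exact ⟨y, hy, fun v X ↦ by simpa using hm _ _ (isReparam_unipotent v) X⟩

lemma IsEquivariantFamily.isCompact_unipotentFixed (h : IsEquivariantFamily ρ k Q)
    {E : Type*} [NormedAddCommGroup E] [NormedSpace ℝ E] (hk : IsKernelFamily E k)
    (hF : IsCompact F) (W : Submodule ℝ V) : IsCompact (unipotentFixed b k Q W F) := by
  refine (hF.inter_right (hk.isClosed_le W)).inter_right ?_
  simp only [Set.ofPred_forall]
  exact isClosed_iInter fun v ↦ isClosed_iInter fun X ↦
    isClosed_eq (h.continuous_form _) (h.continuous_form _)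

/-- A hyperbolic element of `Γ` provides, in each compact invariant set, a point whose form is
invariant up to scalars under the diagonal group. -/
lemma IsEquivariantFamily.exists_form_diagonal_invariant (h : IsEquivariantFamily ρ k Q)
    (hF : IsCompact F) (hF' : F.Nonempty) (hinv : ∀ s : Γ, ∀ x ∈ F, s • x ∈ F)
    {c : Γ} {a : ℝ} (ha : 1 < a) (hc : ρ c = borel b a 0) :
    ∃ y ∈ F, ∀ v > 0, ∃ r > 0, ∀ X, Q y (borel b v 0 X) = r * Q y X := by
  have ha0 : 0 < a := one_pos.trans ha
  obtain ⟨y, hy, m, hm⟩ := h.exists_form_invariant (D := diagonalCoeff b) hF hF' hinv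
    (tendsto_pow_atTop_atTop_of_one_lt ha) (a := fun i ↦ a ^ i) (fun i ↦ (pow_pos ha0 i).ne')
    (c := c) (fun i ↦ by
      rw [quadraticCurve_diagonalCoeff (pow_pos ha0 i).ne', borel_pow ha0.ne' hc (Or.inr rfl)]
      simp)
  -- The reparametrizing endomorphism is `v • borel b v 0`, and the extra scalar contributes `v * v`
  -- to a quadratic form.
  refine ⟨y, hy, fun v hv ↦ ⟨v ^ m / (v * v), by positivity, fun X ↦ ?_⟩⟩
  have := hm _ _ (isReparam_diagonal hv) X
  rw [LinearMap.smul_apply, QuadraticMap.map_smul, smul_eq_mul] at this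
  field_simp
  linear_combination this

/-- If `Γ` acts on `V` through a Borel group, then each nonempty compact invariant set contains a
point that is fixed in the projective sense. -/
theorem IsEquivariantFamily.exists_fixed_of_borel (h : IsEquivariantFamily ρ k Q)
    {E : Type*} [NormedAddCommGroup E] [NormedSpace ℝ E] (hk : IsKernelFamily E k)
    (hF : IsCompact F) (hF' : F.Nonempty) (hinv : ∀ s : Γ, ∀ x ∈ F, s • x ∈ F)
    (hρ : ∀ s, ∃ a t, 0 < a ∧ ρ s = borel b a t) :
    ∃ x ∈ F, ∀ s, (∀ X ∈ k x, ρ s X ∈ k x) ∧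
      ∃ r : ℝ, 0 < r ∧ ∀ X, Q x (ρ s X) = r * Q x X := by
  have hV : Module.finrank ℝ V = 3 := by simp [Module.finrank_eq_card_basis b]
  choose a t ha hat using hρ
  by_cases h1 : ∀ s, a s = 1
  · by_cases h2 : ∀ s, t s = 0
    · obtain ⟨x, hx⟩ := hF'
      have : ∀ s X, ρ s X = X := fun s X ↦ by
        rw [hat, h1, h2, borel_one_zero_eq_id, LinearMap.id_apply]
      exact ⟨x, hx, fun s ↦ ⟨fun X hX ↦ by rwa [this], 1, one_pos, fun X ↦ by rw [this, one_mul]⟩⟩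
    · push Not at h2
      obtain ⟨c, hc⟩ := h2
      obtain ⟨W, hWmax, hW, x, hx⟩ := h.exists_unipotentFixed hk hF hF' hinv
        (fun s ↦ ⟨a s, t s, ha s, hat s⟩) hc (by rw [hat, h1])
      refine ⟨x, hx.1.1, fun s ↦ ⟨?_, 1, one_pos, fun X ↦ ?_⟩⟩
      · rw [hWmax x hx.1.1 hx.1.2]; exact hW s
      · rw [hat, h1, hx.2, one_mul]
  · push Not at h1
    obtain ⟨s₀, hs₀⟩ := h1
    wlog ht₀ : t s₀ = 0 generalizing b t
    -- The shift is the root `r` of `t s₀ + (a s₀ - 1) r = 0`.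
    · refine this (b := b.map (unipotentEquiv b (t s₀ / (1 - a s₀))))
        (t := fun s ↦ t s + (a s - 1) * (t s₀ / (1 - a s₀))) (fun s ↦ ?_) ?_
      · rw [borel_map_unipotentEquiv (ha s).ne', hat]
      · have : 1 - a s₀ ≠ 0 := sub_ne_zero.2 hs₀.symm
        field_simp
        ring
    wlog ha₀ : 1 < a s₀ generalizing s₀
    · have hs : ρ s₀⁻¹ = borel b (a s₀)⁻¹ 0 := by
        rw [rep_inv_eq_borel (ha s₀).ne' (hat s₀), ht₀]; simp
      obtain ⟨e1, e2⟩ := borel_inj ((hat s₀⁻¹).symm.trans hs)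
      have hlt : 1 < a s₀⁻¹ := by
        rw [e1]
        exact (one_lt_inv₀ (ha s₀)).2 (lt_of_le_of_ne (not_lt.1 ha₀) hs₀)
      exact this s₀⁻¹ hlt.ne' e2 hlt
    have hs₀' : ρ s₀ = borel b (a s₀) 0 := by rw [hat, ht₀]
    by_cases h2 : ∀ s, t s = 0
    · obtain ⟨W, hWne, hWmax, hWR⟩ := h.exists_kernel_invariant (D := diagonalCoeff b) hk hV hF hF'
        hinv (tendsto_pow_atTop_atTop_of_one_lt ha₀) (a := fun i ↦ a s₀ ^ i)
        (fun i ↦ (pow_pos (ha s₀) i).ne') (c := s₀) (fun i ↦ by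
          rw [quadraticCurve_diagonalCoeff (pow_pos (ha s₀) i).ne',
            borel_pow (ha s₀).ne' hs₀' (Or.inr rfl)]
          simp)
      have hW : ∀ s, ∀ X ∈ W, ρ s X ∈ W := fun s X hX ↦ by
        have := hWR _ _ (isReparam_diagonal (ha s)) X hX
        rw [LinearMap.smul_apply, Submodule.smul_mem_iff _ (ha s).ne'] at this
        rwa [hat, h2]
      obtain ⟨y, hy, hyQ⟩ := h.exists_form_diagonal_invariant (F := F ∩ {x | W ≤ k x})
        (hF.inter_right (hk.isClosed_le W)) (by obtain ⟨y, hy⟩ := hWne; exact ⟨y, hy⟩)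
        (fun s x hx ↦ ⟨hinv s x hx.1, h.le_smul hW s hx.2⟩) ha₀ hs₀'
      refine ⟨y, hy.1, fun s ↦ ⟨?_, ?_⟩⟩
      · rw [hWmax y hy.1 hy.2]; exact hW s
      · rw [hat, h2]; exact hyQ _ (ha s)
    · push Not at h2
      obtain ⟨s₁, hs₁⟩ := h2
      -- The commutator of the hyperbolic element with a non-diagonal one is a nontrivial unipotent
      -- element.
      have hcomm : ρ (s₁ * s₀ * (s₀ * s₁)⁻¹) = borel b 1 ((1 - a s₀) * t s₁) := by
        have e : ρ (s₁ * s₀ * (s₀ * s₁)⁻¹) ∘ₗ ρ (s₀ * s₁) = ρ (s₁ * s₀) := by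
          rw [← Module.End.mul_eq_comp, ← map_mul, inv_mul_cancel_right]
        rw [map_mul ρ s₀, map_mul ρ s₁ s₀, Module.End.mul_eq_comp, Module.End.mul_eq_comp,
          hat (_ * _), hat s₀, hat s₁, ht₀, borel_comp (ha _).ne' (ha _).ne',
          borel_comp (ha _).ne' (mul_pos (ha _) (ha _)).ne', borel_comp (ha _).ne' (ha _).ne'] at e
        obtain ⟨e1, e2⟩ := borel_inj e
        have e3 : a (s₁ * s₀ * (s₀ * s₁)⁻¹) = 1 := by
          have := ha s₀; have := ha s₁
          field_simp at e1
          linarith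
        rw [e3] at e2
        rw [hat, e3]
        congr 1
        linarith
      obtain ⟨W, hWmax, hW, hne⟩ := h.exists_unipotentFixed hk hF hF' hinv
        (fun s ↦ ⟨a s, t s, ha s, hat s⟩)
        (mul_ne_zero (sub_ne_zero.2 hs₀.symm) hs₁) hcomm
      -- The hyperbolic element acts on the compact set of unipotent-fixed points, so the new point
      -- keeps the invariance already gained.
      obtain ⟨y, hy, hyQ⟩ := h.exists_form_diagonal_invariant
        (h.isCompact_unipotentFixed hk hF W) hne (fun s x hx ↦ h.unipotentFixed_smul hinv hW
          (fun s ↦ ⟨a s, t s, ha s, hat s⟩) s hx) ha₀ hs₀'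
      refine ⟨y, hy.1.1, fun s ↦ ⟨?_, ?_⟩⟩
      · rw [hWmax y hy.1.1 hy.1.2]; exact hW s
      · obtain ⟨r, hr, hr'⟩ := hyQ _ (ha s)
        refine ⟨r, hr, fun X ↦ ?_⟩
        have : ρ s = borel b 1 (t s) ∘ₗ borel b (a s) 0 := by
          rw [borel_comp one_ne_zero (ha s).ne', hat]; simp
        rw [this, LinearMap.comp_apply, hy.2, hr']

end EquivariantFamilies

/-! ### Standard triples in three-dimensional Lie algebras -/

section Sl2

variable {V : Type*} [LieRing V] [LieAlgebra ℝ V]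

/-- The three elements of the basis form a standard triple `e`, `h`, `f` of `𝔰𝔩(2, ℝ)`. -/
structure IsSl2Basis (b : Module.Basis (Fin 3) ℝ V) : Prop where
  lie_h_e : ⁅b 1, b 0⁆ = (2 : ℝ) • b 0
  lie_h_f : ⁅b 1, b 2⁆ = (-2 : ℝ) • b 2
  lie_e_f : ⁅b 0, b 2⁆ = b 1

variable {b : Module.Basis (Fin 3) ℝ V}

lemma IsSl2Basis.lie_combination (hb : IsSl2Basis b) (x y z x' y' z' : ℝ) :
    ⁅x • b 0 + y • b 1 + z • b 2, x' • b 0 + y' • b 1 + z' • b 2⁆ =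
      (2 * (y * x' - x * y')) • b 0 + (x * z' - z * x') • b 1 + (2 * (z * y' - y * z')) • b 2 := by
  have h1 : ⁅b 0, b 1⁆ = (-2 : ℝ) • b 0 := by rw [← lie_skew, hb.lie_h_e]; module
  have h2 : ⁅b 2, b 1⁆ = (2 : ℝ) • b 2 := by rw [← lie_skew, hb.lie_h_f]; module
  have h3 : ⁅b 2, b 0⁆ = (-1 : ℝ) • b 1 := by rw [← lie_skew, hb.lie_e_f]; module
  simp only [add_lie, lie_add, smul_lie, lie_smul, lie_self, h1, h2, h3, hb.lie_h_e, hb.lie_h_f,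
    hb.lie_e_f]
  module

/-- Cayley–Hamilton for `ad X`: its eigenvalues are `0` and `±2√(y² + xz)`, where `y² + xz` is minus
the determinant of the matrix with rows `(y, x)` and `(z, -y)`. -/
lemma IsSl2Basis.lie_lie_lie (hb : IsSl2Basis b) (x y z : ℝ) (Y : V) :
    ⁅x • b 0 + y • b 1 + z • b 2, ⁅x • b 0 + y • b 1 + z • b 2, ⁅x • b 0 + y • b 1 + z • b 2, Y⁆⁆⁆ =
      (4 * (y ^ 2 + x * z)) • ⁅x • b 0 + y • b 1 + z • b 2, Y⁆ := by
  obtain ⟨x', y', z', rfl⟩ := exists_eq_combination (b := b) Y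
  simp only [hb.lie_combination]
  match_scalars <;> ring

/-- The centralizer of a nonzero element is the line that it spans. -/
lemma IsSl2Basis.exists_smul_eq_of_lie_eq_zero (hb : IsSl2Basis b) {X Y : V} (hX : X ≠ 0)
    (h : ⁅X, Y⁆ = 0) : ∃ r : ℝ, Y = r • X := by
  obtain ⟨x, y, z, rfl⟩ := exists_eq_combination (b := b) X
  obtain ⟨x', y', z', rfl⟩ := exists_eq_combination (b := b) Y
  rw [hb.lie_combination] at h
  obtain ⟨h1, h2, h3⟩ := combination_inj (b := b) (x' := 0) (y' := 0) (z' := 0) (by simpa using h)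
  by_cases hx : x = 0
  · by_cases hy : y = 0
    · have hz : z ≠ 0 := by rintro rfl; simp [hx, hy] at hX
      refine ⟨z' / z, ?_⟩
      subst hx hy
      match_scalars
      · simpa [hz] using h2
      · simpa [hz] using h3
      · field_simp
    · refine ⟨y' / y, ?_⟩
      subst hx
      match_scalars
      · simpa [hy] using h1
      · field_simp
      · field_simp; linarith
  · refine ⟨x' / x, ?_⟩
    match_scalars
    · field_simp
    · field_simp; linarith
    · field_simp; linarith

/-- Elements that satisfy the relations of a standard triple form a basis. -/
lemma exists_isSl2Basis (hV : Module.finrank ℝ V = 3) {e h f : V} (he : e ≠ 0)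
    (h_e : ⁅h, e⁆ = (2 : ℝ) • e) (h_f : ⁅h, f⁆ = (-2 : ℝ) • f) (e_f : ⁅e, f⁆ = h) :
    ∃ b : Module.Basis (Fin 3) ℝ V, IsSl2Basis b ∧ b 0 = e ∧ b 1 = h ∧ b 2 = f := by
  have eh : ⁅e, h⁆ = (-2 : ℝ) • e := by rw [← lie_skew, h_e]; module
  have hli : LinearIndependent ℝ ![e, h, f] := by
    rw [Fintype.linearIndependent_iff]
    intro g hg
    simp only [Fin.sum_univ_three, Matrix.cons_val_zero, Matrix.cons_val_one,
      Matrix.cons_val] at hg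
    -- Since `ad e` sends `f` to `h`, `h` to a multiple of `e`, and `e` to `0`, two brackets isolate
    -- `g 2`, then one isolates `g 1`.
    have h1 : ⁅e, g 0 • e + g 1 • h + g 2 • f⁆ = 0 := by rw [hg, lie_zero]
    have h2 : ⁅e, ⁅e, g 0 • e + g 1 • h + g 2 • f⁆⁆ = 0 := by rw [h1, lie_zero]
    simp only [lie_add, lie_smul, lie_self, eh, e_f, smul_zero, zero_add] at h1 h2
    rw [smul_smul, smul_eq_zero] at h2
    have g2 : g 2 = 0 := by simpa [he] using h2
    rw [g2, zero_smul, add_zero, smul_smul, smul_eq_zero] at h1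
    have g1 : g 1 = 0 := by simpa [he] using h1
    rw [g1, g2] at hg
    have g0 : g 0 = 0 := by simpa [he] using hg
    intro i
    fin_cases i <;> assumption
  let b := basisOfLinearIndependentOfCardEqFinrank hli (by simp [hV])
  have hb : ⇑b = ![e, h, f] := coe_basisOfLinearIndependentOfCardEqFinrank _ _
  exact ⟨b, ⟨by simp [hb, h_e], by simp [hb, h_f], by simp [hb, e_f]⟩, by simp [hb], by simp [hb],
    by simp [hb]⟩

/-- A nonzero nilpotent element belongs to a standard triple. -/
lemma IsSl2Basis.exists_of_nilpotent (hb : IsSl2Basis b) {x y z : ℝ}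
    (hX : x • b 0 + y • b 1 + z • b 2 ≠ 0) (hd : y ^ 2 + x * z = 0) :
    ∃ b' : Module.Basis (Fin 3) ℝ V, IsSl2Basis b' ∧ b' 0 = x • b 0 + y • b 1 + z • b 2 := by
  have hV : Module.finrank ℝ V = 3 := by simp [Module.finrank_eq_card_basis b]
  have hn : x - z ≠ 0 := by
    intro h
    have hxz : x = z := by linarith
    subst hxz
    have hx : x = 0 := by nlinarith [sq_nonneg x, sq_nonneg y]
    have hy : y = 0 := by nlinarith [sq_nonneg x, sq_nonneg y]
    simp [hx, hy] at hX
  -- The vector `f` will be `m` times the transpose of the nilpotent matrix `X`, whose squared norm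
  -- `2y² + x² + z²` equals `(x - z)²`.
  obtain ⟨m, hm⟩ : ∃ m, m * (x - z) ^ 2 = 1 := ⟨_, inv_mul_cancel₀ (pow_ne_zero 2 hn)⟩
  obtain ⟨b', hb', h0, -, -⟩ := exists_isSl2Basis hV hX
    (h := ⁅x • b 0 + y • b 1 + z • b 2, (m * z) • b 0 + (m * y) • b 1 + (m * x) • b 2⁆)
    (f := (m * z) • b 0 + (m * y) • b 1 + (m * x) • b 2) (by
      simp only [hb.lie_combination]
      match_scalars
      · linear_combination (-4 * m * (z - x)) * hd + 2 * x * hm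
      · linear_combination 2 * y * hm
      · linear_combination (4 * m * (z - x)) * hd + 2 * z * hm) (by
      simp only [hb.lie_combination]
      match_scalars
      · linear_combination (-4 * m ^ 2 * (z - x)) * hd - 2 * m * z * hm
      · linear_combination -2 * m * y * hm
      · linear_combination (4 * m ^ 2 * (z - x)) * hd - 2 * m * x * hm) rfl
  exact ⟨b', hb', h0⟩

/-- An element of determinant one is the standard rotation of a standard triple. -/
lemma IsSl2Basis.exists_of_elliptic (hb : IsSl2Basis b) {x y z : ℝ} (hd : y ^ 2 + x * z = -1) :
    ∃ b' : Module.Basis (Fin 3) ℝ V, IsSl2Basis b' ∧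
      b' 2 - b' 0 = x • b 0 + y • b 1 + z • b 2 := by
  have hV : Module.finrank ℝ V = 3 := by simp [Module.finrank_eq_card_basis b]
  have hz : z ≠ 0 := by rintro rfl; nlinarith [sq_nonneg y]
  -- Take `e = z⁻¹ • b 0` and let `f` be `e` plus the given element; its `b 0` coefficient is `x +
  -- z⁻¹ = -(y² / z)`.
  obtain ⟨b', hb', h0, -, h2⟩ := exists_isSl2Basis hV
    (e := z⁻¹ • b 0 + (0 : ℝ) • b 1 + (0 : ℝ) • b 2)
    (h := (-(2 * y / z)) • b 0 + (1 : ℝ) • b 1 + (0 : ℝ) • b 2)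
    (f := (-(y ^ 2 / z)) • b 0 + y • b 1 + z • b 2)
    (by simpa using ⟨hz, b.ne_zero 0⟩)
    (by rw [hb.lie_combination]; match_scalars <;> field_simp <;> ring)
    (by rw [hb.lie_combination]; match_scalars <;> field_simp <;> ring)
    (by rw [hb.lie_combination]; match_scalars <;> field_simp <;> ring)
  refine ⟨b', hb', ?_⟩
  rw [h0, h2]
  match_scalars
  · field_simp; linarith
  · ring
  · ring

/-- An automorphism of `𝔰𝔩(2, ℝ)` that preserves the line spanned by the first element of a standard
triple belongs to the Borel group. -/
lemma IsSl2Basis.exists_eq_borel (hb : IsSl2Basis b) {T : V →ₗ[ℝ] V}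
    (hT : ∀ X Y, T ⁅X, Y⁆ = ⁅T X, T Y⁆) {a : ℝ} (ha : a ≠ 0) (h0 : T (b 0) = a • b 0) :
    ∃ t, T = borel b a t := by
  obtain ⟨x, y, z, h1⟩ := exists_eq_combination (b := b) (T (b 1))
  obtain ⟨x', y', z', h2⟩ := exists_eq_combination (b := b) (T (b 2))
  have h0' : T (b 0) = a • b 0 + (0 : ℝ) • b 1 + (0 : ℝ) • b 2 := by rw [h0]; module
  have e1 := hT (b 1) (b 0)
  have e2 := hT (b 0) (b 2)
  have e3 := hT (b 1) (b 2)
  rw [hb.lie_h_e, map_smul, h1, h0', hb.lie_combination] at e1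
  rw [hb.lie_e_f, h0', h1, h2, hb.lie_combination] at e2
  rw [hb.lie_h_f, map_smul, h1, h2, hb.lie_combination] at e3
  simp only [smul_add, smul_smul] at e1 e3
  obtain ⟨a1, a2, a3⟩ := combination_inj e1
  obtain ⟨b1, b2, b3⟩ := combination_inj e2
  obtain ⟨c1, c2, c3⟩ := combination_inj e3
  have hz : z = 0 := by
    have : z * a = 0 := by linarith
    simpa [ha] using this
  have hy : y = 1 := by
    have : (y - 1) * a = 0 := by linarith
    have := (mul_eq_zero.1 this).resolve_right ha
    linarith
  subst hz hy
  have hz' : z' = a⁻¹ := by field_simp; linarith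
  have hy' : y' = -(x / (2 * a)) := by field_simp; linarith
  have hx' : x' = -(x ^ 2 / (4 * a)) := by
    rw [hy'] at c1
    field_simp at c1 ⊢
    linarith
  refine ⟨x, linearMap_ext_three (b := b) ?_ ?_ ?_⟩
  · rw [h0, borel_zero]
  · rw [h1, borel_one]; module
  · rw [h2, borel_two, hx', hy', hz']; module

end Sl2

/-! ### Rotations about the standard elliptic element -/

section Rotation

variable {V : Type*} [AddCommGroup V] [Module ℝ V] (b : Module.Basis (Fin 3) ℝ V)

/-- The endomorphism that fixes `b 2 - b 0` and acts on the plane spanned by `b 1` and `b 0 + b 2`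
as multiplication by `p + i q`. -/
def rotation (p q : ℝ) : V →ₗ[ℝ] V :=
  b.constr ℝ ![((p + 1) / 2) • b 0 + (-(q / 2)) • b 1 + ((p - 1) / 2) • b 2,
    q • b 0 + p • b 1 + q • b 2, ((p - 1) / 2) • b 0 + (-(q / 2)) • b 1 + ((p + 1) / 2) • b 2]

lemma rotation_zero (p q : ℝ) : rotation b p q (b 0) =
    ((p + 1) / 2) • b 0 + (-(q / 2)) • b 1 + ((p - 1) / 2) • b 2 := by simp [rotation]
lemma rotation_one (p q : ℝ) : rotation b p q (b 1) = q • b 0 + p • b 1 + q • b 2 := by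
  simp [rotation]
lemma rotation_two (p q : ℝ) : rotation b p q (b 2) =
    ((p - 1) / 2) • b 0 + (-(q / 2)) • b 1 + ((p + 1) / 2) • b 2 := by simp [rotation]

lemma rotation_comp (p q p' q' : ℝ) : rotation b p q ∘ₗ rotation b p' q' =
    rotation b (p * p' - q * q') (p * q' + q * p') := by
  refine linearMap_ext_three (b := b) ?_ ?_ ?_ <;>
    simp only [LinearMap.comp_apply, rotation_zero, rotation_one, rotation_two, map_add,
      map_smul] <;>
    match_scalars <;> ring

lemma rotation_one_zero : rotation b 1 0 = LinearMap.id := by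
  refine linearMap_ext_three (b := b) ?_ ?_ ?_ <;>
    simp [rotation_zero, rotation_one, rotation_two]

variable {b} in
lemma rotation_inj {p q p' q' : ℝ} (h : rotation b p q = rotation b p' q') : p = p' ∧ q = q' := by
  have h1 := LinearMap.congr_fun h (b 1)
  rw [rotation_one, rotation_one] at h1
  obtain ⟨h1, h2, -⟩ := combination_inj h1
  exact ⟨h2, h1⟩

end Rotation

/-! ### Connected automorphism groups with an invariant subspace -/

section Classification

variable {V : Type*} [LieRing V] [LieAlgebra ℝ V] {b : Module.Basis (Fin 3) ℝ V}

/-- An automorphism of `𝔰𝔩(2, ℝ)` that fixes the standard elliptic element is a rotation. -/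
lemma IsSl2Basis.exists_eq_rotation (hb : IsSl2Basis b) {T : V →ₗ[ℝ] V}
    (hT : ∀ X Y, T ⁅X, Y⁆ = ⁅T X, T Y⁆) (h : T (b 2 - b 0) = b 2 - b 0) :
    ∃ p q : ℝ, p ^ 2 + q ^ 2 = 1 ∧ T = rotation b p q := by
  obtain ⟨x, y, z, h1⟩ := exists_eq_combination (b := b) (T (b 1))
  have hJ : b 2 - b 0 = (-1 : ℝ) • b 0 + (0 : ℝ) • b 1 + (1 : ℝ) • b 2 := by module
  have e1 := hT (b 1) (b 2 - b 0)
  rw [h, h1, lie_sub, hb.lie_h_e, hb.lie_h_f, hJ, hb.lie_combination, map_sub, map_smul,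
    map_smul] at e1
  rw [map_sub] at h
  -- Bracketing `b 1` with `b 2 - b 0` gives `-2 (b 0 + b 2)`, so `T (b 1)` determines `T (b 0 + b
  -- 2)`; the difference `b 2 - b 0` is fixed.
  have h0 : T (b 0) = ((y + 1) / 2) • b 0 + (-((x + z) / 4)) • b 1 + ((y - 1) / 2) • b 2 := by
    linear_combination (norm := module) (-1 / 4 : ℝ) • e1 - (1 / 2 : ℝ) • h
  have h2 : T (b 2) = ((y - 1) / 2) • b 0 + (-((x + z) / 4)) • b 1 + ((y + 1) / 2) • b 2 := by
    linear_combination (norm := module) (-1 / 4 : ℝ) • e1 + (1 / 2 : ℝ) • h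
  have e2 := hT (b 1) (b 0)
  rw [hb.lie_h_e, map_smul, h1, h0, hb.lie_combination] at e2
  simp only [smul_add, smul_smul] at e2
  obtain ⟨a1, a2, a3⟩ := combination_inj e2
  have f1 : y ^ 2 + x * (x + z) / 2 = 1 := by linear_combination -a1
  have f2 : y * (x - z) = 0 := by linear_combination -2 * a2
  have f3 : (x - z) * (x + z) = 0 := by linear_combination -2 * a1 - 2 * a3
  have hxz : x = z := by
    by_contra hne
    have hne' := sub_ne_zero.2 hne
    have hy : y = 0 := (mul_eq_zero.1 f2).resolve_right hne'
    have hx : x + z = 0 := (mul_eq_zero.1 f3).resolve_left hne'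
    rw [hy, hx] at f1
    norm_num at f1
  subst hxz
  refine ⟨y, x, by linarith, linearMap_ext_three (b := b) ?_ ?_ ?_⟩
  · rw [h0, rotation_zero]; match_scalars <;> ring
  · rw [h1, rotation_one]
  · rw [h2, rotation_two]; match_scalars <;> ring

variable {Γ : Type*} [Group Γ] {ρ : Γ →* Module.End ℝ V}

/-- A nonzero proper invariant subspace of `𝔰𝔩(2, ℝ)` gives an invariant line. -/
lemma IsSl2Basis.exists_invariant_line (hb : IsSl2Basis b)
    (hT : ∀ s X Y, ρ s ⁅X, Y⁆ = ⁅ρ s X, ρ s Y⁆) {W : Submodule ℝ V} (hW0 : W ≠ ⊥) (hW1 : W ≠ ⊤)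
    (hW : ∀ s, ∀ X ∈ W, ρ s X ∈ W) : ∃ X : V, X ≠ 0 ∧ ∀ s, ∃ a : ℝ, ρ s X = a • X := by
  have hV : Module.finrank ℝ V = 3 := by simp [Module.finrank_eq_card_basis b]
  have : FiniteDimensional ℝ V := Module.finite_of_finrank_pos (by omega)
  have hlt := Submodule.finrank_lt hW1
  have hpos : Module.finrank ℝ W ≠ 0 := fun h ↦ hW0 (Submodule.finrank_eq_zero.1 h)
  obtain h | h : Module.finrank ℝ W = 1 ∨ Module.finrank ℝ W = 2 := by omega
  · obtain ⟨w, hw0, hw⟩ := finrank_eq_one_iff'.1 h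
    refine ⟨w, by simpa using hw0, fun s ↦ ?_⟩
    obtain ⟨a, ha⟩ := hw ⟨ρ s w, hW s w w.2⟩
    exact ⟨a, (congrArg Subtype.val ha).symm⟩
  · let c := Module.finBasisOfFinrankEq ℝ W h
    have hc : ∀ X ∈ W, ∃ r t : ℝ, X = r • (c 0 : V) + t • (c 1 : V) := fun X hX ↦ by
      have := c.sum_repr ⟨X, hX⟩
      rw [Fin.sum_univ_two] at this
      exact ⟨_, _, (congrArg Subtype.val this).symm⟩
    -- For an invariant plane the bracket of two basis vectors spans an invariant line, scaled by
    -- the determinant on the plane. It is nonzero because centralizers are lines.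
    refine ⟨⁅(c 0 : V), (c 1 : V)⁆, fun h0 ↦ ?_, fun s ↦ ?_⟩
    · obtain ⟨r, hr⟩ := hb.exists_smul_eq_of_lie_eq_zero (by simpa using c.ne_zero 0) h0
      have hr' : c 1 = r • c 0 := Subtype.ext hr
      have := congrArg (fun X ↦ c.repr X 1) hr'
      simp at this
    · obtain ⟨r, t, h0⟩ := hc _ (hW s _ (c 0).2)
      obtain ⟨r', t', h1⟩ := hc _ (hW s _ (c 1).2)
      refine ⟨r * t' - t * r', ?_⟩
      rw [hT, h0, h1]
      simp only [add_lie, lie_add, smul_lie, lie_smul, lie_self]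
      rw [← lie_skew (c 0 : V) (c 1 : V)]
      module

variable [TopologicalSpace Γ] [ConnectedSpace Γ]

lemma pos_of_continuous_of_ne_zero {f : Γ → ℝ} (hf : Continuous f) (h0 : ∀ s, f s ≠ 0)
    (h1 : 0 < f 1) (s : Γ) : 0 < f s := by
  by_contra! hs
  obtain ⟨r, hr⟩ := mem_range_of_exists_le_of_exists_ge hf ⟨s, hs⟩ ⟨1, h1.le⟩
  exact h0 r hr

lemma exists_dual_eq_one {X : V} [FiniteDimensional ℝ V] (hX : X ≠ 0) :
    ∃ φ : V →ₗ[ℝ] ℝ, φ X = 1 := by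
  have : ∃ φ : V →ₗ[ℝ] ℝ, φ X ≠ 0 := by
    by_contra! h
    exact hX ((Module.forall_dual_apply_eq_zero_iff ℝ X).1 h)
  obtain ⟨φ, hφ⟩ := this
  exact ⟨(φ X)⁻¹ • φ, by simp [hφ]⟩

/-- A connected group that preserves a line acts on it by positive scalars. -/
lemma exists_pos_smul_eq [FiniteDimensional ℝ V]
    (hcont : ∀ X (φ : V →ₗ[ℝ] ℝ), Continuous fun s ↦ φ (ρ s X)) {X : V} (hX : X ≠ 0)
    (h : ∀ s, ∃ a : ℝ, ρ s X = a • X) (s : Γ) : ∃ a : ℝ, 0 < a ∧ ρ s X = a • X := by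
  choose a ha using h
  obtain ⟨φ, hφ⟩ := exists_dual_eq_one hX
  have hφa : ∀ s, φ (ρ s X) = a s := fun s ↦ by simp [ha, hφ]
  refine ⟨a s, pos_of_continuous_of_ne_zero (f := a) (by simpa only [hφa] using hcont X φ)
    (fun s hs ↦ hX ?_) ?_ s, ha s⟩
  · rw [← rep_inv_apply (ρ := ρ) s X, ha, hs, zero_smul, map_zero]
  · rw [← hφa, map_one, Module.End.one_apply, hφ]; exact one_pos

/-- A connected group of rotations is trivial or contains all rotations. -/
lemma rotation_dichotomy (hcont : ∀ X (φ : V →ₗ[ℝ] ℝ), Continuous fun s ↦ φ (ρ s X))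
    (h : ∀ s, ∃ p q : ℝ, p ^ 2 + q ^ 2 = 1 ∧ ρ s = rotation b p q) :
    (∀ s, ρ s = LinearMap.id) ∨
      ∀ φ : ℝ, ∃ s, ρ s = rotation b (Real.cos φ) (Real.sin φ) := by
  choose p q hpq hρ using h
  have hp : Continuous p := by
    refine (hcont (b 1) (b.coord 1)).congr fun s ↦ ?_
    rw [hρ, rotation_one]; simp
  have hp1 : p 1 = 1 := by
    have : rotation b (p 1) (q 1) = rotation b 1 0 := by
      rw [← hρ, map_one, rotation_one_zero]; rfl
    exact (rotation_inj this).1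
  by_cases hall : ∀ s, p s = 1
  · left
    intro s
    have : q s = 0 := by have := hpq s; rw [hall] at this; nlinarith
    rw [hρ, hall, this, rotation_one_zero]
  right
  push Not at hall
  obtain ⟨s₁, hs₁⟩ := hall
  have hlt : p s₁ < 1 := lt_of_le_of_ne (by nlinarith [hpq s₁, sq_nonneg (q s₁)]) hs₁
  have hge : -1 ≤ p s₁ := by nlinarith [hpq s₁, sq_nonneg (q s₁)]
  let A : AddSubgroup ℝ :=
    { carrier := {φ | ∃ s, ρ s = rotation b (Real.cos φ) (Real.sin φ)}
      zero_mem' := ⟨1, by simp [rotation_one_zero]; rfl⟩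
      add_mem' := by
        rintro φ ψ ⟨s, hs⟩ ⟨s', hs'⟩
        refine ⟨s * s', ?_⟩
        rw [map_mul, Module.End.mul_eq_comp, hs, hs', rotation_comp, Real.cos_add, Real.sin_add]
        congr 1; ring
      neg_mem' := by
        rintro φ ⟨s, hs⟩
        refine ⟨s⁻¹, ?_⟩
        ext X
        have h1 : rotation b (Real.cos (-φ)) (Real.sin (-φ)) ∘ₗ ρ s = LinearMap.id := by
          rw [hs, rotation_comp, ← rotation_one_zero (b := b), Real.cos_neg, Real.sin_neg]
          congr 1
          · linear_combination Real.cos_sq_add_sin_sq φ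
          · ring
        rw [← rep_apply_inv (ρ := ρ) s X, rep_inv_apply]
        exact (LinearMap.congr_fun h1 _).symm }
  -- The cosine `p` takes all values between `p s₁` and `1` by connectedness. The undetermined sign
  -- of the sine is absorbed by `A` being closed under negation, and a subgroup containing an
  -- interval is all of `ℝ`.
  have hsmall : ∀ θ, 0 ≤ θ → θ ≤ Real.arccos (p s₁) → θ ∈ A := by
    intro θ h0 h1
    have hcos : p s₁ ≤ Real.cos θ := by
      rw [← Real.cos_arccos hge hlt.le]
      exact Real.cos_le_cos_of_nonneg_of_le_pi h0 (Real.arccos_le_pi _) h1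
    obtain ⟨s, hs⟩ := mem_range_of_exists_le_of_exists_ge hp ⟨s₁, hcos⟩
      ⟨1, hp1 ▸ Real.cos_le_one θ⟩
    have hq : q s = Real.sin θ ∨ q s = -Real.sin θ := by
      rw [← sq_eq_sq_iff_eq_or_eq_neg]
      have := hpq s
      rw [hs] at this
      linarith [Real.cos_sq_add_sin_sq θ]
    rcases hq with hq | hq
    · exact ⟨s, by rw [hρ, hs, hq]⟩
    · rw [← neg_mem_iff]
      exact ⟨s, by rw [hρ, hs, hq, Real.cos_neg, Real.sin_neg]⟩
  have hpos : 0 < Real.arccos (p s₁) := Real.arccos_pos.2 hlt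
  have habs : ∀ φ, 0 ≤ φ → φ ∈ A := by
    intro φ h0
    obtain ⟨n, hn⟩ := exists_nat_gt (φ / Real.arccos (p s₁))
    have hn0 : (0 : ℝ) < n := lt_of_le_of_lt (by positivity) hn
    have := A.nsmul_mem (hsmall (φ / n) (by positivity) (by
      rw [div_le_iff₀ hn0, mul_comm]
      rw [div_lt_iff₀ hpos] at hn
      exact hn.le)) n
    rwa [nsmul_eq_mul, mul_div_cancel₀ _ hn0.ne'] at this
  intro φ
  rcases le_total 0 φ with h | h
  · exact habs φ h
  · have := A.neg_mem (habs (-φ) (by linarith))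
    rwa [neg_neg] at this

/-- A connected group of automorphisms of `𝔰𝔩(2, ℝ)` that preserves a nonzero proper subspace is
contained in a Borel group or is the group of all rotations. -/
theorem IsSl2Basis.borel_or_elliptic (hb : IsSl2Basis b)
    (hT : ∀ s X Y, ρ s ⁅X, Y⁆ = ⁅ρ s X, ρ s Y⁆)
    (hcont : ∀ X (φ : V →ₗ[ℝ] ℝ), Continuous fun s ↦ φ (ρ s X))
    {W : Submodule ℝ V} (hW0 : W ≠ ⊥) (hW1 : W ≠ ⊤) (hW : ∀ s, ∀ X ∈ W, ρ s X ∈ W) :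
    (∃ b' : Module.Basis (Fin 3) ℝ V, ∀ s, ∃ a t, 0 < a ∧ ρ s = borel b' a t) ∨
    ∃ b' : Module.Basis (Fin 3) ℝ V, IsSl2Basis b' ∧
      ∀ T, (∃ s, ρ s = T) ↔ ∃ φ : ℝ, T = rotation b' (Real.cos φ) (Real.sin φ) := by
  have hV : Module.finrank ℝ V = 3 := by simp [Module.finrank_eq_card_basis b]
  have : FiniteDimensional ℝ V := Module.finite_of_finrank_pos (by omega)
  have hnil : ∀ x y z : ℝ, x • b 0 + y • b 1 + z • b 2 ≠ 0 → y ^ 2 + x * z = 0 →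
      (∀ s, ∃ a : ℝ, ρ s (x • b 0 + y • b 1 + z • b 2) = a • (x • b 0 + y • b 1 + z • b 2)) →
      ∃ b' : Module.Basis (Fin 3) ℝ V, ∀ s, ∃ a t, 0 < a ∧ ρ s = borel b' a t := by
    intro x y z hX hd hline
    obtain ⟨b', hb', h0⟩ := hb.exists_of_nilpotent hX hd
    refine ⟨b', fun s ↦ ?_⟩
    obtain ⟨a, ha, has⟩ := exists_pos_smul_eq hcont hX hline s
    rw [← h0] at has
    obtain ⟨t, ht⟩ := hb'.exists_eq_borel (hT s) ha.ne' has
    exact ⟨a, t, ha, ht⟩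
  obtain ⟨X, hX, hline⟩ := hb.exists_invariant_line hT hW0 hW1 hW
  obtain ⟨x, y, z, rfl⟩ := exists_eq_combination (b := b) X
  by_cases hd : y ^ 2 + x * z = 0
  · exact Or.inl (hnil x y z hX hd hline)
  -- Applying `ρ s` to the cubic identity for `ad X` gives `a³ = a`, and `a > 0` by connectedness,
  -- so the invariant line is fixed pointwise.
  have hfix : ∀ s, ρ s (x • b 0 + y • b 1 + z • b 2) = x • b 0 + y • b 1 + z • b 2 := by
    intro s
    obtain ⟨a, ha, has⟩ := exists_pos_smul_eq hcont hX hline s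
    obtain ⟨Y, hY⟩ : ∃ Y : V, ⁅x • b 0 + y • b 1 + z • b 2, ρ s Y⁆ ≠ 0 := by
      by_contra! hall
      have hall' : ∀ Y : V, ⁅x • b 0 + y • b 1 + z • b 2, Y⁆ = 0 := fun Y ↦ by
        have := hall (ρ s⁻¹ Y); rwa [rep_apply_inv] at this
      obtain ⟨r, hr⟩ := hb.exists_smul_eq_of_lie_eq_zero hX (hall' (b 0))
      obtain ⟨r', hr'⟩ := hb.exists_smul_eq_of_lie_eq_zero hX (hall' (b 1))
      generalize x • b 0 + y • b 1 + z • b 2 = X at hr hr'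
      have h2 := hb.lie_h_e
      rw [hr, hr', smul_lie, lie_smul, lie_self, smul_zero, smul_zero, ← hr] at h2
      exact smul_ne_zero two_ne_zero (b.ne_zero 0) h2.symm
    have e := congrArg (ρ s) (hb.lie_lie_lie x y z Y)
    rw [map_smul] at e
    simp only [hT, has] at e
    simp only [smul_lie, lie_smul, hb.lie_lie_lie, smul_smul] at e
    have e' : (a * (a * (a * (4 * (y ^ 2 + x * z)))) - 4 * (y ^ 2 + x * z) * a) •
        ⁅x • b 0 + y • b 1 + z • b 2, ρ s Y⁆ = 0 := by
      rw [sub_smul, sub_eq_zero]; convert e using 2; ring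
    have e2 := (smul_eq_zero.1 e').resolve_right hY
    have e3 : (4 * a * (y ^ 2 + x * z) * (a + 1)) * (a - 1) = 0 := by linear_combination e2
    have e4 : a - 1 = 0 := (mul_eq_zero.1 e3).resolve_left (by positivity)
    rw [has, show a = 1 by linarith, one_smul]
  obtain ⟨c, hc, hc'⟩ : ∃ c : ℝ, c ≠ 0 ∧ (c ^ 2 * (y ^ 2 + x * z) = 1 ∨
      c ^ 2 * (y ^ 2 + x * z) = -1) := by
    have habs := abs_pos.2 hd
    refine ⟨(√|y ^ 2 + x * z|)⁻¹, by positivity, ?_⟩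
    rw [inv_pow, Real.sq_sqrt habs.le]
    rcases lt_or_gt_of_ne hd with h | h
    · right; rw [abs_of_neg h]; field_simp
    · left; rw [abs_of_pos h]; field_simp
  have hfix' : ∀ s, ρ s ((c * x) • b 0 + (c * y) • b 1 + (c * z) • b 2) =
      (c * x) • b 0 + (c * y) • b 1 + (c * z) • b 2 := fun s ↦ by
    have := congrArg (c • ·) (hfix s)
    simpa only [← map_smul, smul_add, smul_smul] using this
  rcases hc' with h1 | h1
  · left
    replace h1 : (c * y) ^ 2 + (c * x) * (c * z) = 1 := by linear_combination h1
    generalize c * x = x at *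
    generalize c * y = y at *
    generalize c * z = z at *
    set X := x • b 0 + y • b 1 + z • b 2 with hXdef
    have h3 : ∀ Y : V, ⁅X, ⁅X, ⁅X, Y⁆⁆⁆ = (4 : ℝ) • ⁅X, Y⁆ := fun Y ↦ by
      rw [hb.lie_lie_lie, h1, mul_one]
    -- From `(ad X)³ = 4 ad X`, the image of `(ad X)² + 2 ad X` lies in the eigenspace of `ad X` for
    -- `2`; the vector `Z` obtained is nilpotent and gives the Borel group.
    obtain ⟨Y, hY⟩ : ∃ Y : V, ⁅X, ⁅X, Y⁆⁆ + (2 : ℝ) • ⁅X, Y⁆ ≠ 0 := by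
      by_contra! hall
      have h0 := hall ((1 : ℝ) • b 0 + (0 : ℝ) • b 1 + (0 : ℝ) • b 2)
      have h2 := hall ((0 : ℝ) • b 0 + (0 : ℝ) • b 1 + (1 : ℝ) • b 2)
      simp only [hXdef, hb.lie_combination] at h0 h2
      have k0 : (4 * y ^ 2 + 2 * x * z + 4 * y) • b 0 + (-2 * y * z - 2 * z) • b 1 +
          (-2 * z ^ 2) • b 2 = (0 : ℝ) • b 0 + (0 : ℝ) • b 1 + (0 : ℝ) • b 2 := by
        linear_combination (norm := module) h0
      have k2 : (-2 * x ^ 2) • b 0 + (-2 * x * y + 2 * x) • b 1 +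
          (2 * x * z + 4 * y ^ 2 - 4 * y) • b 2 =
            (0 : ℝ) • b 0 + (0 : ℝ) • b 1 + (0 : ℝ) • b 2 := by
        linear_combination (norm := module) h2
      obtain ⟨l1, -, l2⟩ := combination_inj k0
      obtain ⟨-, -, l3⟩ := combination_inj k2
      have hz0 : z = 0 := by simpa using l2
      have hy0 : y = 0 := by linarith
      rw [hz0, hy0] at h1
      norm_num at h1
    set Z := ⁅X, ⁅X, Y⁆⁆ + (2 : ℝ) • ⁅X, Y⁆ with hZdef
    have hXZ : ⁅X, Z⁆ = (2 : ℝ) • Z := by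
      rw [hZdef, lie_add, lie_smul, h3]; module
    have hline' : ∀ s, ∃ a : ℝ, ρ s Z = a • Z := fun s ↦ by
      refine hb.exists_smul_eq_of_lie_eq_zero hY ?_
      have hs : ⁅X, ρ s Z⁆ = (2 : ℝ) • ρ s Z := by
        rw [← map_smul, ← hXZ, hT, hfix']
      -- The bracket of two eigenvectors for `2` would have eigenvalue `4`, which the cubic identity
      -- forbids. So `ρ s Z` commutes with `Z` and is a multiple of it.
      have h4 : ⁅X, ⁅Z, ρ s Z⁆⁆ = (4 : ℝ) • ⁅Z, ρ s Z⁆ := by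
        rw [leibniz_lie, hXZ, hs, smul_lie, lie_smul]; module
      have h5 := h3 ⁅Z, ρ s Z⁆
      rw [h4, lie_smul, h4, lie_smul, lie_smul, h4] at h5
      have h6 : (48 : ℝ) • ⁅Z, ρ s Z⁆ = 0 := by
        linear_combination (norm := module) h5
      exact (smul_eq_zero.1 h6).resolve_left (by norm_num)
    obtain ⟨x', y', z', hZ⟩ := exists_eq_combination (b := b) Z
    rw [hZ] at hY hline' hXZ
    refine hnil x' y' z' hY ?_ hline'
    have h4 := hb.lie_lie_lie x' y' z' X
    have h5 : ⁅x' • b 0 + y' • b 1 + z' • b 2, X⁆ =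
        (-2 : ℝ) • (x' • b 0 + y' • b 1 + z' • b 2) := by
      rw [← lie_skew, hXZ]; module
    rw [h5, lie_smul, lie_self, smul_zero, lie_zero] at h4
    have h6 := (smul_eq_zero.1 h4.symm).resolve_right (smul_ne_zero (by norm_num) hY)
    linarith
  · replace h1 : (c * y) ^ 2 + (c * x) * (c * z) = -1 := by linear_combination h1
    obtain ⟨b', hb', hJ⟩ := hb.exists_of_elliptic h1
    rw [← hJ] at hfix'
    have hrot := fun s ↦ hb'.exists_eq_rotation (hT s) (hfix' s)
    rcases rotation_dichotomy hcont hrot with h | h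
    · exact Or.inl ⟨b', fun s ↦ ⟨1, 0, one_pos, by rw [h, borel_one_zero_eq_id]⟩⟩
    · refine Or.inr ⟨b', hb', fun T ↦ ⟨?_, ?_⟩⟩
      · rintro ⟨s, rfl⟩
        obtain ⟨p, q, hpq, hs⟩ := hrot s
        obtain ⟨φ, hp, hq⟩ : ∃ φ, Real.cos φ = p ∧ Real.sin φ = q := by
          have hn : ‖(⟨p, q⟩ : ℂ)‖ = 1 := by
            rw [Complex.norm_def, Complex.normSq_mk, ← pow_two, ← pow_two, hpq, Real.sqrt_one]
          have h0 : (⟨p, q⟩ : ℂ) ≠ 0 := by rw [← norm_ne_zero_iff, hn]; exact one_ne_zero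
          exact ⟨Complex.arg ⟨p, q⟩, by rw [Complex.cos_arg h0, hn, div_one],
            by rw [Complex.sin_arg, hn, div_one]⟩
        exact ⟨φ, by rw [hs, hp, hq]⟩
      · rintro ⟨φ, rfl⟩
        exact h φ

end Classification

/-! ### Multiplication to first order in a chart at the identity -/

section ClosedSubgroup

open Filter Topology

variable {EH : Type*} [NormedAddCommGroup EH] [NormedSpace ℝ EH]
  {H : Type*} [TopologicalSpace H] [ChartedSpace EH H] [Group H]

variable (EH) in
/-- The preferred chart at the identity, translated so that it sends the identity to `0`. -/
def centeredChart (h : H) : EH := extChartAt 𝓘(ℝ, EH) (1 : H) h - extChartAt 𝓘(ℝ, EH) (1 : H) 1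

variable (EH H) in
/-- The inverse of the centered chart. -/
def centeredChartSymm (v : EH) : H :=
  (extChartAt 𝓘(ℝ, EH) (1 : H)).symm (v + extChartAt 𝓘(ℝ, EH) (1 : H) 1)

variable (EH H) in
/-- The domain of the centered chart. -/
def chartDomain : Set H := (extChartAt 𝓘(ℝ, EH) (1 : H)).source

lemma one_mem_chartDomain : (1 : H) ∈ chartDomain EH H := mem_extChartAt_source (1 : H)

lemma chartDomain_mem_nhds : chartDomain EH H ∈ 𝓝 (1 : H) := extChartAt_source_mem_nhds (1 : H)

@[simp] lemma centeredChart_one : centeredChart EH (1 : H) = 0 := sub_self _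

@[simp] lemma centeredChartSymm_zero : centeredChartSymm EH H 0 = 1 := by
  simp [centeredChartSymm]

lemma centeredChartSymm_centeredChart {h : H} (hh : h ∈ chartDomain EH H) :
    centeredChartSymm EH H (centeredChart EH h) = h := by
  rw [centeredChartSymm, centeredChart, sub_add_cancel]
  exact (extChartAt 𝓘(ℝ, EH) (1 : H)).left_inv hh

lemma continuousAt_centeredChart : ContinuousAt (centeredChart EH) (1 : H) :=
  (continuousAt_extChartAt (1 : H)).sub continuousAt_const

lemma exists_ball_target : ∃ δ > 0, ∀ v : EH, ‖v‖ < δ →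
    centeredChartSymm EH H v ∈ chartDomain EH H ∧
    centeredChart EH (centeredChartSymm EH H v) = v ∧
      ContinuousAt (centeredChartSymm EH H) v := by
  have h := extChartAt_target_mem_nhds (I := 𝓘(ℝ, EH)) (1 : H)
  obtain ⟨δ, hδ, hb⟩ := Metric.mem_nhds_iff.1 h
  refine ⟨δ, hδ, fun v hv ↦ ?_⟩
  have hv' : v + extChartAt 𝓘(ℝ, EH) (1 : H) 1 ∈ (extChartAt 𝓘(ℝ, EH) (1 : H)).target :=
    hb (by simpa [dist_eq_norm] using hv)
  refine ⟨(extChartAt 𝓘(ℝ, EH) (1 : H)).map_target hv', ?_, ?_⟩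
  · rw [centeredChart, centeredChartSymm, (extChartAt 𝓘(ℝ, EH) (1 : H)).right_inv hv',
      add_sub_cancel_right]
  · exact (continuousAt_extChartAt_symm'' hv').comp (f := fun v ↦ v + _) (by fun_prop)

/-- The sets defined by the norm of the centered chart are a basis of neighborhoods of `1`. -/
lemma exists_centeredChart_lt_imp_mem {U : Set H} (hU : U ∈ 𝓝 (1 : H)) :
    ∃ δ > 0, ∀ h ∈ chartDomain EH H, ‖centeredChart EH h‖ < δ → h ∈ U := by
  obtain ⟨δ₀, hδ₀, hb⟩ := exists_ball_target (EH := EH) (H := H)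
  have hc := (hb 0 (by simpa using hδ₀)).2.2
  have hU' : centeredChartSymm EH H ⁻¹' U ∈ 𝓝 (0 : EH) :=
    hc.preimage_mem_nhds (by simpa using hU)
  obtain ⟨δ, hδ, hb'⟩ := Metric.mem_nhds_iff.1 hU'
  refine ⟨δ, hδ, fun h hh hlt ↦ ?_⟩
  have := hb' (show centeredChart EH h ∈ Metric.ball 0 δ by simpa using hlt)
  rwa [Set.mem_preimage, centeredChartSymm_centeredChart hh] at this

variable [LieGroup 𝓘(ℝ, EH) ∞ H]

lemma contDiffAt_chart_mul : ContDiffAt ℝ 1 (fun z : EH × EH ↦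
    centeredChart EH (centeredChartSymm EH H z.1 * centeredChartSymm EH H z.2)) 0 := by
  rw [← contMDiffAt_iff_contDiffAt]
  have hsymm : ContMDiffAt 𝓘(ℝ, EH) 𝓘(ℝ, EH) ∞ (centeredChartSymm EH H) 0 := by
    have h1 : ContMDiffAt 𝓘(ℝ, EH) 𝓘(ℝ, EH) ∞ (extChartAt 𝓘(ℝ, EH) (1 : H)).symm
        (extChartAt 𝓘(ℝ, EH) (1 : H) 1) :=
      (contMDiffOn_extChartAt_symm (1 : H)).contMDiffAt (extChartAt_target_mem_nhds (1 : H))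
    refine ContMDiffAt.comp (0 : EH) (by simpa using h1) (?_ : ContMDiffAt 𝓘(ℝ, EH) 𝓘(ℝ, EH) ∞
      (fun v : EH ↦ v + extChartAt 𝓘(ℝ, EH) (1 : H) 1) 0)
    exact (contDiff_id.add contDiff_const).contMDiff.contMDiffAt
  have hfst : ContMDiffAt 𝓘(ℝ, EH × EH) 𝓘(ℝ, EH) ∞
      (fun z : EH × EH ↦ centeredChartSymm EH H z.1) 0 :=
    ContMDiffAt.comp (0 : EH × EH) (g := centeredChartSymm EH H) hsymm
      (contDiff_fst.contMDiff.contMDiffAt)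
  have hsnd : ContMDiffAt 𝓘(ℝ, EH × EH) 𝓘(ℝ, EH) ∞
      (fun z : EH × EH ↦ centeredChartSymm EH H z.2) 0 :=
    ContMDiffAt.comp (0 : EH × EH) (g := centeredChartSymm EH H) hsymm
      (contDiff_snd.contMDiff.contMDiffAt)
  have hchart : ContMDiffAt 𝓘(ℝ, EH) 𝓘(ℝ, EH) ∞ (centeredChart EH) (1 : H) :=
    (contMDiffAt_extChartAt (x := (1 : H))).sub contMDiffAt_const
  have := ContMDiffAt.comp (0 : EH × EH) (g := centeredChart EH)
    (f := fun z : EH × EH ↦ centeredChartSymm EH H z.1 * centeredChartSymm EH H z.2)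
    (by simpa using hchart) (hfst.mul hsnd)
  exact this.of_le (by simp)

/-- Multiplication is addition up to first order, uniformly near the identity. -/
lemma exists_norm_centeredChart_mul_sub_le {η : ℝ} (hη : 0 < η) :
    ∃ δ > 0, ∀ g ∈ chartDomain EH H, ∀ h ∈ chartDomain EH H, ‖centeredChart EH g‖ < δ →
      ‖centeredChart EH h‖ < δ → g * h ∈ chartDomain EH H ∧
        ‖centeredChart EH (g * h) - centeredChart EH g - centeredChart EH h‖ ≤
          η * ‖centeredChart EH h‖ := by
  set m : EH × EH → EH := fun z ↦
    centeredChart EH (centeredChartSymm EH H z.1 * centeredChartSymm EH H z.2) with hm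
  have hstrict := (contDiffAt_chart_mul (EH := EH) (H := H)).hasStrictFDerivAt (by simp)
  obtain ⟨δ₀, hδ₀, hb⟩ := exists_ball_target (EH := EH) (H := H)
  have hD : ∀ v : EH, fderiv ℝ m 0 (0, v) = v := by
    have h1 : HasFDerivAt (fun v : EH ↦ m (0, v))
        (fderiv ℝ m 0 ∘L ContinuousLinearMap.inr ℝ EH EH) 0 := by
      refine HasFDerivAt.comp (g := m) (f := fun v : EH ↦ ((0 : EH), v)) 0 ?_
        (hasFDerivAt_prodMk_right 0 0)
      exact hstrict.hasFDerivAt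
    have h2 : (fun v : EH ↦ m (0, v)) =ᶠ[𝓝 0] id := by
      filter_upwards [Metric.ball_mem_nhds (0 : EH) hδ₀] with v hv
      simp [hm, (hb v (by simpa using hv)).2.1]
    have h3 := h1.unique ((hasFDerivAt_id 0).congr_of_eventuallyEq h2)
    intro v
    simpa using DFunLike.congr_fun h3 v
  have ho := hstrict.isLittleO.def hη
  rw [nhds_prod_eq, eventually_prod_iff] at ho
  obtain ⟨pa, hpa, pb, hpb, hab⟩ := ho
  obtain ⟨δ₁, hδ₁, hb₁⟩ := Metric.eventually_nhds_iff.1 (hpa.and hpb)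
  have hdom : ∀ᶠ z : H × H in 𝓝 ((1 : H), (1 : H)), z.1 * z.2 ∈ chartDomain EH H := by
    have : ContinuousMul H := continuousMul_of_contMDiffMul 𝓘(ℝ, EH) ∞
    have hc : ContinuousAt (fun z : H × H ↦ z.1 * z.2) (1, 1) := by fun_prop
    exact hc.preimage_mem_nhds (by simpa using chartDomain_mem_nhds)
  rw [nhds_prod_eq, eventually_prod_iff] at hdom
  obtain ⟨qa, hqa, qb, hqb, hqab⟩ := hdom
  obtain ⟨δ₂, hδ₂, hb₂⟩ := exists_centeredChart_lt_imp_mem (EH := EH) (hqa.and hqb)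
  refine ⟨min δ₁ δ₂, lt_min hδ₁ hδ₂, fun g hg h hh hgδ hhδ ↦ ⟨?_, ?_⟩⟩
  · exact hqab (hb₂ g hg (hgδ.trans_le (min_le_right _ _))).1
      (hb₂ h hh (hhδ.trans_le (min_le_right _ _))).2
  · have hz1 : ‖(centeredChart EH g, centeredChart EH h)‖ < δ₁ :=
      max_lt (hgδ.trans_le (min_le_left _ _)) (hhδ.trans_le (min_le_left _ _))
    have hz2 : ‖(centeredChart EH g, (0 : EH))‖ < δ₁ :=
      max_lt (hgδ.trans_le (min_le_left _ _)) (by simpa using hδ₁)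
    -- Strict differentiability is applied to `(g, h)` and `(g, 0)`, so the error is bounded by the
    -- size of `h` alone.
    have := hab
      (hb₁ (y := (centeredChart EH g, centeredChart EH h)) (by rw [dist_zero_right]; exact hz1)).1
      (hb₁ (y := (centeredChart EH g, 0)) (by rw [dist_zero_right]; exact hz2)).2
    rw [← hm, Prod.mk_sub_mk, sub_self, sub_zero, hD, Prod.norm_mk, norm_zero,
      max_eq_right (norm_nonneg _)] at this
    simpa [hm, centeredChartSymm_centeredChart hg, centeredChartSymm_centeredChart hh] using this

end ClosedSubgroup

/-! ### The tangent space of a closed subgroup -/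

section ClosedSubgroup

open Filter Topology

variable {EH : Type*} [NormedAddCommGroup EH] [NormedSpace ℝ EH]
  {H : Type*} [TopologicalSpace H] [ChartedSpace EH H] [Group H]

/-- A vector is tangent to `S` if the points `h • X`, for small `h > 0`, are at distance `o(h)`
from `S` in the centered chart. -/
def IsTangentTo (S : Subgroup H) (X : EH) : Prop :=
  ∀ η > 0, ∀ᶠ h : ℝ in 𝓝[>] 0, ∃ s ∈ S, s ∈ chartDomain EH H ∧ ‖centeredChart EH s - h • X‖ ≤ η * h

lemma norm_le_of_norm_sub_smul_le {v X : EH} {η h : ℝ} (hh : 0 < h) (hv : ‖v - h • X‖ ≤ η * h) :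
    ‖v‖ ≤ (‖X‖ + η) * h := by
  have := norm_add_le (v - h • X) (h • X)
  rw [sub_add_cancel, norm_smul, Real.norm_of_nonneg hh.le] at this
  linarith

lemma eventually_mul_lt (a : ℝ) {δ : ℝ} (hδ : 0 < δ) : ∀ᶠ h : ℝ in 𝓝[>] 0, a * h < δ := by
  have : ContinuousAt (fun h : ℝ ↦ a * h) 0 := by fun_prop
  exact (this.eventually (Iio_mem_nhds (by simpa using hδ))).filter_mono nhdsWithin_le_nhds

/-- A self-map of the group fixing the identity, with derivative `L` there, that preserves `S`,
sends tangent vectors to tangent vectors. -/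
lemma IsTangentTo.map {S : Subgroup H} {f : H → H} (hf : ∀ s ∈ S, f s ∈ S) {L : EH →L[ℝ] EH}
    (hL : ∀ κ > 0, ∃ δ > 0, ∀ s ∈ chartDomain EH H, ‖centeredChart EH s‖ < δ →
      f s ∈ chartDomain EH H ∧
        ‖centeredChart EH (f s) - L (centeredChart EH s)‖ ≤ κ * ‖centeredChart EH s‖)
    {X : EH} (hX : IsTangentTo S X) : IsTangentTo S (L X) := by
  intro η hη
  have hη' : 0 < η / (2 * (‖L‖ + 1)) := by positivity
  have hB : 0 < ‖X‖ + η / (2 * (‖L‖ + 1)) := by positivity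
  obtain ⟨δ, hδ, hδ'⟩ := hL (η / 2 / (‖X‖ + η / (2 * (‖L‖ + 1)))) (by positivity)
  filter_upwards [hX _ hη', eventually_mul_lt (‖X‖ + η / (2 * (‖L‖ + 1))) hδ,
    self_mem_nhdsWithin] with h ⟨s, hs, hsd, hsX⟩ hlt hpos
  rw [Set.mem_Ioi] at hpos
  have hn := norm_le_of_norm_sub_smul_le hpos hsX
  obtain ⟨h1, h2⟩ := hδ' s hsd (hn.trans_lt hlt)
  refine ⟨f s, hf s hs, h1, ?_⟩
  have h3 : ‖L (centeredChart EH s - h • X)‖ ≤ η / 2 * h := by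
    calc _ ≤ ‖L‖ * (η / (2 * (‖L‖ + 1)) * h) :=
          (L.le_opNorm _).trans (mul_le_mul_of_nonneg_left hsX (norm_nonneg _))
      _ ≤ (‖L‖ + 1) * (η / (2 * (‖L‖ + 1)) * h) := by gcongr; linarith
      _ = _ := by field_simp
  have h4 : η / 2 / (‖X‖ + η / (2 * (‖L‖ + 1))) * ‖centeredChart EH s‖ ≤ η / 2 * h := by
    calc _ ≤ η / 2 / (‖X‖ + η / (2 * (‖L‖ + 1))) * ((‖X‖ + η / (2 * (‖L‖ + 1))) * h) := by gcongr
      _ = _ := by field_simp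
  have h5 := norm_add_le (centeredChart EH (f s) - L (centeredChart EH s))
    (L (centeredChart EH s - h • X))
  have h6 : centeredChart EH (f s) - L (centeredChart EH s) + L (centeredChart EH s - h • X)
      = centeredChart EH (f s) - h • L X := by
    rw [map_sub, map_smul]; abel
  rw [h6] at h5
  linarith

lemma isTangentTo_zero (S : Subgroup H) : IsTangentTo S (0 : EH) := by
  intro η hη
  filter_upwards [self_mem_nhdsWithin] with h hpos
  exact ⟨1, S.one_mem, one_mem_chartDomain, by simpa using (mul_pos hη hpos).le⟩

lemma IsTangentTo.pos_smul {S : Subgroup H} {X : EH} (hX : IsTangentTo S X) {c : ℝ} (hc : 0 < c) :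
    IsTangentTo S (c • X) := by
  intro η hη
  have ht : Tendsto (fun h : ℝ ↦ c * h) (𝓝[>] 0) (𝓝[>] 0) := by
    refine tendsto_nhdsWithin_iff.2 ⟨?_, ?_⟩
    · have : ContinuousAt (fun h : ℝ ↦ c * h) 0 := by fun_prop
      simpa using this.tendsto.mono_left (nhdsWithin_le_nhds (s := Set.Ioi (0 : ℝ)))
    · filter_upwards [self_mem_nhdsWithin] with h hpos using mul_pos hc hpos
  filter_upwards [ht.eventually (hX (η / c) (by positivity))] with h ⟨s, hs, hsd, hsX⟩
  refine ⟨s, hs, hsd, ?_⟩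
  rw [smul_smul, mul_comm h c]
  exact hsX.trans_eq (by field_simp)

variable [LieGroup 𝓘(ℝ, EH) ∞ H]

/-- Inversion is negation up to first order near the identity. -/
lemma exists_norm_centeredChart_inv_add_le {κ : ℝ} (hκ : 0 < κ) :
    ∃ δ > 0, ∀ s ∈ chartDomain EH H, ‖centeredChart EH s‖ < δ →
      s⁻¹ ∈ chartDomain EH H ∧
        ‖centeredChart EH s⁻¹ - (-ContinuousLinearMap.id ℝ EH) (centeredChart EH s)‖ ≤
          κ * ‖centeredChart EH s‖ := by
  have : IsTopologicalGroup H := topologicalGroup_of_lieGroup 𝓘(ℝ, EH) ∞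
  obtain ⟨δ, hδ, hmul⟩ := exists_norm_centeredChart_mul_sub_le (EH := EH) (H := H)
    (η := min (1 / 2) (κ / 2)) (by positivity)
  have hinv : ∀ᶠ s in 𝓝 (1 : H), s⁻¹ ∈ chartDomain EH H ∧ ‖centeredChart EH s⁻¹‖ < δ := by
    have hc : Tendsto (fun s : H ↦ s⁻¹) (𝓝 1) (𝓝 1) := by
      simpa using (continuous_inv (G := H)).tendsto 1
    refine hc.eventually (p := fun s ↦ s ∈ chartDomain EH H ∧ ‖centeredChart EH s‖ < δ)
      (Filter.Eventually.and chartDomain_mem_nhds ?_)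
    exact continuousAt_centeredChart.norm.eventually (Iio_mem_nhds (by simpa using hδ))
  obtain ⟨δ', hδ', hU⟩ := exists_centeredChart_lt_imp_mem (EH := EH) hinv
  refine ⟨min δ δ', lt_min hδ hδ', fun s hs hlt ↦ ?_⟩
  obtain ⟨hd, hn⟩ := hU s hs (hlt.trans_le (min_le_right _ _))
  refine ⟨hd, ?_⟩
  -- Apply the product estimate to `s * s⁻¹ = 1`. The bound `1 / 2` in the minimum controls `s⁻¹` by
  -- `2 ‖s‖`; the bound `κ / 2` then gives the claim.
  have h1 := (hmul s hs s⁻¹ hd (hlt.trans_le (min_le_left _ _)) hn).2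
  rw [mul_inv_cancel, centeredChart_one, zero_sub, ← neg_add', norm_neg] at h1
  have h2 : ‖centeredChart EH s⁻¹‖ ≤ 2 * ‖centeredChart EH s‖ := by
    have h3 : ‖centeredChart EH s⁻¹‖ ≤
        ‖centeredChart EH s + centeredChart EH s⁻¹‖ + ‖centeredChart EH s‖ := by
      simpa using norm_sub_le (centeredChart EH s + centeredChart EH s⁻¹) (centeredChart EH s)
    have h4 : min (1 / 2) (κ / 2) * ‖centeredChart EH s⁻¹‖ ≤ 1 / 2 * ‖centeredChart EH s⁻¹‖ := by
      gcongr; exact min_le_left _ _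
    linarith
  have h5 : min (1 / 2) (κ / 2) * ‖centeredChart EH s⁻¹‖ ≤ κ / 2 * (2 * ‖centeredChart EH s‖) := by
    gcongr; exact min_le_right _ _
  have h6 : centeredChart EH s⁻¹ - (-ContinuousLinearMap.id ℝ EH) (centeredChart EH s) =
      centeredChart EH s + centeredChart EH s⁻¹ := by
    simp [add_comm]
  rw [h6]
  linarith

lemma IsTangentTo.neg {S : Subgroup H} {X : EH} (hX : IsTangentTo S X) : IsTangentTo S (-X) := by
  simpa using hX.map (f := fun s ↦ s⁻¹) (fun s hs ↦ S.inv_mem hs)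
    (fun κ hκ ↦ exists_norm_centeredChart_inv_add_le hκ)

lemma IsTangentTo.add {S : Subgroup H} {X Y : EH} (hX : IsTangentTo S X) (hY : IsTangentTo S Y) :
    IsTangentTo S (X + Y) := by
  intro η hη
  have hη' : 0 < η / 3 := by positivity
  have hB : 0 < ‖Y‖ + η / 3 := by positivity
  obtain ⟨δ, hδ, hmul⟩ := exists_norm_centeredChart_mul_sub_le (EH := EH) (H := H)
    (η := η / 3 / (‖Y‖ + η / 3)) (by positivity)
  filter_upwards [hX _ hη', hY _ hη', eventually_mul_lt (‖X‖ + η / 3) hδ,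
    eventually_mul_lt (‖Y‖ + η / 3) hδ, self_mem_nhdsWithin]
    with h ⟨s, hs, hsd, hsX⟩ ⟨t, ht, htd, htY⟩ hltX hltY hpos
  rw [Set.mem_Ioi] at hpos
  have hnX := norm_le_of_norm_sub_smul_le hpos hsX
  have hnY := norm_le_of_norm_sub_smul_le hpos htY
  obtain ⟨h1, h2⟩ := hmul s hsd t htd (hnX.trans_lt hltX) (hnY.trans_lt hltY)
  refine ⟨s * t, S.mul_mem hs ht, h1, ?_⟩
  have h3 : η / 3 / (‖Y‖ + η / 3) * ‖centeredChart EH t‖ ≤ η / 3 * h := by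
    calc _ ≤ η / 3 / (‖Y‖ + η / 3) * ((‖Y‖ + η / 3) * h) := by gcongr
      _ = _ := by field_simp
  have h4 : centeredChart EH (s * t) - h • (X + Y) =
      (centeredChart EH (s * t) - centeredChart EH s - centeredChart EH t) +
        (centeredChart EH s - h • X) + (centeredChart EH t - h • Y) := by
    rw [smul_add]; abel
  rw [h4]
  refine (norm_add₃_le).trans ?_
  linarith

variable (EH) in
/-- The tangent space at the identity of a subgroup of a Lie group. -/
def tangentSubmodule (S : Subgroup H) : Submodule ℝ EH where
  carrier := {X | IsTangentTo S X}
  zero_mem' := isTangentTo_zero S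
  add_mem' := fun hX hY ↦ hX.add hY
  smul_mem' := by
    intro c X hX
    rcases lt_trichotomy c 0 with hc | rfl | hc
    · simpa using (show IsTangentTo S X from hX).neg.pos_smul (neg_pos.2 hc)
    · simpa using isTangentTo_zero (EH := EH) S
    · exact (show IsTangentTo S X from hX).pos_smul hc

lemma mem_tangentSubmodule {S : Subgroup H} {X : EH} :
    X ∈ tangentSubmodule EH S ↔ IsTangentTo S X := Iff.rfl

/-- A conjugation is its differential up to first order near the identity. -/
lemma exists_norm_centeredChart_conj_sub_le (g : H) {κ : ℝ} (hκ : 0 < κ) :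
    ∃ δ > 0, ∀ s ∈ chartDomain EH H, ‖centeredChart EH s‖ < δ →
      g * s * g⁻¹ ∈ chartDomain EH H ∧
        ‖centeredChart EH (g * s * g⁻¹) -
          modelDeriv EH EH (fun k : H ↦ g * k * g⁻¹) 1 (centeredChart EH s)‖ ≤
          κ * ‖centeredChart EH s‖ := by
  have hd := (mdifferentiableAt_conj (EH := EH) g (1 : H)).hasMFDerivAt
  have h1 : HasFDerivAt (writtenInExtChartAt 𝓘(ℝ, EH) 𝓘(ℝ, EH) 1 (fun k : H ↦ g * k * g⁻¹))
      (modelDeriv EH EH (fun k : H ↦ g * k * g⁻¹) 1) (extChartAt 𝓘(ℝ, EH) (1 : H) 1) := by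
    have h0 : HasFDerivWithinAt (writtenInExtChartAt 𝓘(ℝ, EH) 𝓘(ℝ, EH) 1
        (fun k : H ↦ g * k * g⁻¹)) (modelDeriv EH EH (fun k : H ↦ g * k * g⁻¹) 1)
        (Set.range 𝓘(ℝ, EH)) (extChartAt 𝓘(ℝ, EH) (1 : H) 1) := hd.2
    rwa [ModelWithCorners.range_eq_univ, hasFDerivWithinAt_univ] at h0
  have hg : g * 1 * g⁻¹ = 1 := by simp
  have h2 := h1.isLittleO.def hκ
  have hev : ∀ᶠ s in 𝓝 (1 : H), g * s * g⁻¹ ∈ chartDomain EH H ∧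
      ‖centeredChart EH (g * s * g⁻¹) -
          modelDeriv EH EH (fun k : H ↦ g * k * g⁻¹) 1 (centeredChart EH s)‖ ≤
          κ * ‖centeredChart EH s‖ := by
    refine Filter.Eventually.and
      (hd.1.preimage_mem_nhds (t := chartDomain EH H) (by simpa using chartDomain_mem_nhds)) ?_
    filter_upwards [(continuousAt_extChartAt (I := 𝓘(ℝ, EH)) (1 : H)).eventually h2,
      chartDomain_mem_nhds (EH := EH)] with s hs hsd
    have hs' := (extChartAt 𝓘(ℝ, EH) (1 : H)).left_inv hsd
    simpa only [writtenInExtChartAt, Function.comp_apply, hs', hg, extChartAt_to_inv,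
      centeredChart] using hs
  obtain ⟨δ, hδ, hU⟩ := exists_centeredChart_lt_imp_mem (EH := EH) hev
  exact ⟨δ, hδ, hU⟩

/-- Conjugation by `s ∈ S` preserves `S` and has derivative `Ad s` at the identity. -/
lemma Ad_mem_tangentSubmodule {S : Subgroup H} {s : H} (hs : s ∈ S) {X : EH}
    (hX : X ∈ tangentSubmodule EH S) : (Ad s X : EH) ∈ tangentSubmodule EH S := by
  refine Eq.mpr (congrArg (· ∈ tangentSubmodule EH S) (Ad_apply s X)) ?_
  exact (mem_tangentSubmodule.1 hX).map
    (fun t ht ↦ S.mul_mem (S.mul_mem hs ht) (S.inv_mem hs))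
    (fun κ hκ ↦ exists_norm_centeredChart_conj_sub_le s hκ)

/-- Each further factor `s` costs an error of only `η ‖s‖`, so the errors add up linearly in `n`. -/
lemma exists_norm_centeredChart_pow_sub_le {η : ℝ} (hη : 0 < η) :
    ∃ δ > 0, ∀ s ∈ chartDomain EH H, ∀ n : ℕ, (1 + η) * (n * ‖centeredChart EH s‖) < δ →
      s ^ n ∈ chartDomain EH H ∧
        ‖centeredChart EH (s ^ n) - (n : ℝ) • centeredChart EH s‖ ≤
          η * (n * ‖centeredChart EH s‖) := by
  obtain ⟨δ, hδ, hmul⟩ := exists_norm_centeredChart_mul_sub_le (EH := EH) (H := H) hη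
  refine ⟨δ, hδ, fun s hs n ↦ ?_⟩
  induction n with
  | zero => intro _; simp [one_mem_chartDomain]
  | succ n ih =>
    intro hlt
    push_cast at hlt ⊢
    have h0 := norm_nonneg (centeredChart EH s)
    have h0' : 0 ≤ (n : ℝ) * ‖centeredChart EH s‖ := by positivity
    obtain ⟨h1, h2⟩ := ih (by nlinarith)
    have h3 : ‖centeredChart EH (s ^ n)‖ ≤ (1 + η) * (n * ‖centeredChart EH s‖) := by
      have := norm_add_le (centeredChart EH (s ^ n) - (n : ℝ) • centeredChart EH s)
        ((n : ℝ) • centeredChart EH s)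
      rw [sub_add_cancel, norm_smul, Real.norm_natCast] at this
      linarith
    obtain ⟨h4, h5⟩ := hmul (s ^ n) h1 s hs (by nlinarith) (by nlinarith)
    rw [pow_succ]
    refine ⟨h4, ?_⟩
    have h6 : centeredChart EH (s ^ n * s) - ((n : ℝ) + 1) • centeredChart EH s =
        (centeredChart EH (s ^ n * s) - centeredChart EH (s ^ n) - centeredChart EH s) +
          (centeredChart EH (s ^ n) - (n : ℝ) • centeredChart EH s) := by
      rw [add_smul, one_smul]; abel
    rw [h6]
    refine (norm_add_le _ _).trans ?_
    linarith

/-- A nontrivial connected subgroup has a nonzero tangent vector. -/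
lemma exists_isTangentTo_ne_zero [FiniteDimensional ℝ EH] {S : Subgroup H}
    (hS : IsConnected (S : Set H)) (hne : S ≠ ⊥) : ∃ X : EH, X ≠ 0 ∧ IsTangentTo S X := by
  have : IsTopologicalGroup H := topologicalGroup_of_lieGroup 𝓘(ℝ, EH) ∞
  -- Otherwise `1` is isolated in `S`, and a connected discrete group is trivial.
  have hsmall : ∀ ε > 0, ∃ s ∈ S, s ∈ chartDomain EH H ∧ 0 < ‖centeredChart EH s‖ ∧
      ‖centeredChart EH s‖ < ε := by
    intro ε hε
    by_contra! hcon
    have hone : ∀ s ∈ S, s ∈ chartDomain EH H → ‖centeredChart EH s‖ < ε → s = 1 := by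
      intro s hs hsd hlt
      by_contra hne1
      refine absurd hlt (not_lt.2 (hcon s hs hsd (norm_pos_iff.2 fun h0 ↦ hne1 ?_)))
      rw [← centeredChartSymm_centeredChart hsd, h0, centeredChartSymm_zero]
    have hopen : IsOpen ({1} : Set S) := by
      rw [isOpen_iff_mem_nhds]
      rintro _ rfl
      have h1 : ∀ᶠ s in 𝓝 (1 : H), s ∈ chartDomain EH H ∧ ‖centeredChart EH s‖ < ε :=
        Filter.Eventually.and chartDomain_mem_nhds
          (continuousAt_centeredChart.norm.eventually (Iio_mem_nhds (by simpa using hε)))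
      filter_upwards [(continuous_subtype_val (p := (· ∈ S))).tendsto 1 |>.eventually h1] with s hs
      exact Subtype.ext (hone s s.2 hs.1 hs.2)
    have hd : DiscreteTopology S := discreteTopology_of_isOpen_singleton_one hopen
    have hc : ConnectedSpace S := isConnected_iff_connectedSpace.1 hS
    have := PreconnectedSpace.trivial_of_discrete (X := S)
    exact hne ((Subgroup.eq_bot_iff_forall S).2 fun s hs ↦
      congrArg Subtype.val (Subsingleton.elim (⟨s, hs⟩ : S) 1))
  choose s hsS hsd hspos hslt using fun n : ℕ ↦ hsmall (1 / (n + 1)) (by positivity)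
  have hu : ∀ n, ‖centeredChart EH (s n)‖⁻¹ • centeredChart EH (s n) ∈
      Metric.sphere (0 : EH) 1 := by
    intro n
    simp [norm_smul, (hspos n).ne']
  obtain ⟨X, hX, φ, hφ, hlim⟩ := (isCompact_sphere (0 : EH) 1).tendsto_subseq hu
  have hX1 : ‖X‖ = 1 := by simpa using hX
  have happrox : ∀ ε > 0, ∃ s ∈ S, s ∈ chartDomain EH H ∧ 0 < ‖centeredChart EH s‖ ∧
      ‖centeredChart EH s‖ < ε ∧
      ‖centeredChart EH s - ‖centeredChart EH s‖ • X‖ ≤ ε * ‖centeredChart EH s‖ := by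
    intro ε hε
    have h1 := (Metric.tendsto_nhds.1 hlim ε hε)
    have h2 := (tendsto_one_div_add_atTop_nhds_zero_nat (𝕜 := ℝ)).comp hφ.tendsto_atTop
    obtain ⟨n, hn1, hn2⟩ := (h1.and (h2.eventually (Iio_mem_nhds hε))).exists
    refine ⟨s (φ n), hsS _, hsd _, hspos _, (hslt _).trans hn2, ?_⟩
    have h3 : centeredChart EH (s (φ n)) - ‖centeredChart EH (s (φ n))‖ • X =
        ‖centeredChart EH (s (φ n))‖ •
          (‖centeredChart EH (s (φ n))‖⁻¹ • centeredChart EH (s (φ n)) - X) := by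
      rw [smul_sub, smul_inv_smul₀ (hspos _).ne']
    rw [h3, norm_smul, norm_norm, mul_comm]
    rw [dist_eq_norm] at hn1
    exact mul_le_mul_of_nonneg_right hn1.le (norm_nonneg _)
  refine ⟨X, by rintro rfl; simp at hX1, fun η hη ↦ ?_⟩
  obtain ⟨δ, hδ, hpow⟩ := exists_norm_centeredChart_pow_sub_le (EH := EH) (H := H)
    (η := η / 4) (by positivity)
  filter_upwards [eventually_mul_lt (1 + η / 4) hδ, self_mem_nhdsWithin] with h hlt hpos
  rw [Set.mem_Ioi] at hpos
  obtain ⟨t, htS, htd, htpos, htlt, htX⟩ := happrox (min (η / 4) (η / 4 * h)) (by positivity)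
  set r := ‖centeredChart EH t‖ with hr
  -- The power `t ^ n` of a tiny element of `S` pointing nearly along `X` comes near `h • X`;
  -- rounding costs at most one step `r`.
  set n := ⌊h / r⌋₊
  have hn1 : n * r ≤ h := (le_div_iff₀ htpos).1 (Nat.floor_le (by positivity))
  have hn2 : h < (n + 1) * r := (div_lt_iff₀ htpos).1 (Nat.lt_floor_add_one _)
  obtain ⟨h1, h2⟩ := hpow t htd n
    ((mul_le_mul_of_nonneg_left hn1 (by positivity)).trans_lt hlt)
  refine ⟨t ^ n, S.pow_mem htS n, h1, ?_⟩
  have h3 : ‖centeredChart EH t - r • X‖ ≤ η / 4 * r :=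
    htX.trans (mul_le_mul_of_nonneg_right (min_le_left _ _) htpos.le)
  have h4 : centeredChart EH (t ^ n) - h • X =
      (centeredChart EH (t ^ n) - (n : ℝ) • centeredChart EH t) +
        (n : ℝ) • (centeredChart EH t - r • X) + (n * r - h) • X := by
    module
  have h5 : r < η / 4 * h := htlt.trans_le (min_le_right _ _)
  have h6 : ‖(n : ℝ) • (centeredChart EH t - r • X)‖ ≤ η / 4 * (n * r) := by
    rw [norm_smul, Real.norm_natCast]
    calc _ ≤ (n : ℝ) * (η / 4 * r) := by gcongr
      _ = _ := by ring
  have h7 : ‖(n * r - h) • X‖ ≤ r := by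
    rw [norm_smul, hX1, mul_one, Real.norm_eq_abs, abs_le]
    constructor <;> linarith
  have h8 : η / 4 * (n * r) ≤ η / 4 * h := by gcongr
  rw [h4]
  refine (norm_add₃_le).trans ?_
  nlinarith [mul_pos hη hpos]

/-- A closed subgroup to which every vector is tangent is a neighborhood of the identity. -/
lemma mem_nhds_one_of_forall_isTangentTo [FiniteDimensional ℝ EH] {S : Subgroup H}
    (hS : IsClosed (S : Set H)) (hall : ∀ X : EH, IsTangentTo S X) : (S : Set H) ∈ 𝓝 1 := by
  have : ProperSpace EH := FiniteDimensional.proper ℝ EH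
  obtain ⟨δ, hδ, hmul⟩ := exists_norm_centeredChart_mul_sub_le (EH := EH) (H := H)
    (η := 1 / 4) (by norm_num)
  obtain ⟨δ₀, hδ₀, hball⟩ := exists_ball_target (EH := EH) (H := H)
  obtain ⟨r, hr, hrδ, hrδ₀⟩ : ∃ r > 0, r < δ ∧ r < δ₀ :=
    ⟨min δ δ₀ / 2, by positivity, by
      have := min_le_left δ δ₀; linarith, by have := min_le_right δ δ₀; linarith⟩
  set K : Set EH := Metric.closedBall 0 r ∩ centeredChartSymm EH H ⁻¹' S
  have hK : IsCompact K := by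
    refine (isCompact_closedBall (0 : EH) r).of_isClosed_subset ?_ Set.inter_subset_left
    refine ContinuousOn.preimage_isClosed_of_isClosed (fun v hv ↦ ?_) Metric.isClosed_closedBall hS
    exact (hball v ((mem_closedBall_zero_iff.1 hv).trans_lt hrδ₀)).2.2.continuousWithinAt
  have h0K : (0 : EH) ∈ K := ⟨by simpa using hr.le, by simp [S.one_mem]⟩
  -- Nearest-point argument: if `p` were not in `K`, its nearest point `v` could be multiplied by an
  -- element of `S` tangent to `p - v`, giving a point of `K` closer to `p`.
  have hmem : ∀ p : EH, ‖p‖ < r / 2 → p ∈ K := by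
    intro p hp
    obtain ⟨v, hvK, hvmin⟩ := hK.exists_isMinOn ⟨0, h0K⟩
      (f := fun v ↦ ‖p - v‖) (by fun_prop)
    have hvmin' : ∀ w ∈ K, ‖p - v‖ ≤ ‖p - w‖ := fun w hw ↦ hvmin hw
    by_cases hpv : p = v
    · rwa [hpv]
    exfalso
    have hd : 0 < ‖p - v‖ := norm_pos_iff.2 (sub_ne_zero.2 hpv)
    set d := ‖p - v‖
    have hd1 : d ≤ ‖p‖ := by simpa using hvmin' 0 h0K
    have hv1 : ‖v‖ < r := by
      have := norm_sub_le p (p - v)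
      rw [sub_sub_cancel] at this
      linarith
    obtain ⟨hvd, hvψ, -⟩ := hball v (hv1.trans hrδ₀)
    obtain ⟨h, ⟨s, hs, hsd, hsX⟩, hlt1, hlt2, hlt3, hpos⟩ :=
      ((hall (p - v) (d / 4) (by positivity)).and ((eventually_mul_lt (d + d / 4) hδ).and
        ((eventually_mul_lt (2 * d) (sub_pos.2 hv1)).and ((eventually_mul_lt 1 one_pos).and
          self_mem_nhdsWithin)))).exists
    have hn := norm_le_of_norm_sub_smul_le hpos hsX
    obtain ⟨h1, h2⟩ := hmul _ hvd s hsd (by rw [hvψ]; exact hv1.trans hrδ) (hn.trans_lt hlt1)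
    rw [hvψ] at h2
    set w := centeredChart EH (centeredChartSymm EH H v * s) with hw
    have hdh := mul_pos hd hpos
    -- The constant is `1/4 · 5/4 + 1/4`, from the product estimate and the tangency estimate; being
    -- below `1`, it leaves a net gain.
    have h3 : ‖w - v - h • (p - v)‖ ≤ 9 / 16 * (d * h) := by
      have h4 : w - v - h • (p - v) = (w - v - centeredChart EH s) +
        (centeredChart EH s - h • (p - v)) := by abel
      rw [h4]
      refine (norm_add_le _ _).trans ?_
      change ‖centeredChart EH s‖ ≤ (d + d / 4) * h at hn
      nlinarith
    have hwK : w ∈ K := by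
      refine ⟨mem_closedBall_zero_iff.2 ?_, ?_⟩
      · have h4 : w = (w - v - h • (p - v)) + h • (p - v) + v := by abel
        rw [h4]
        refine (norm_add₃_le).trans ?_
        rw [norm_smul, Real.norm_of_nonneg hpos.le]
        change _ + h * d + _ ≤ _
        nlinarith
      · rw [Set.mem_preimage, hw, centeredChartSymm_centeredChart h1]
        exact S.mul_mem hvK.2 hs
    have h5 : ‖p - w‖ ≤ (1 - h) * d + 9 / 16 * (d * h) := by
      have h6 : p - w = (1 - h) • (p - v) - (w - v - h • (p - v)) := by module
      rw [h6]
      refine (norm_sub_le _ _).trans ?_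
      rw [norm_smul, Real.norm_of_nonneg (by linarith)]
      gcongr
    have := hvmin' w hwK
    change d ≤ _ at this
    nlinarith
  have hsmall : ∀ᶠ s in 𝓝 (1 : H), ‖centeredChart EH s‖ < r / 2 :=
    continuousAt_centeredChart.norm.eventually (Iio_mem_nhds (by simpa using hr))
  filter_upwards [chartDomain_mem_nhds (EH := EH), hsmall] with s hsd hlt
  have := (hmem _ hlt).2
  rwa [Set.mem_preimage, centeredChartSymm_centeredChart hsd] at this

/-- The tangent space of a proper nontrivial closed connected subgroup is a proper nonzero subspace
of the Lie algebra, invariant under the adjoint action of the subgroup. -/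
theorem exists_Ad_invariant_submodule [FiniteDimensional ℝ EH] [ConnectedSpace H] {S : Subgroup H}
    (hclosed : IsClosed (S : Set H)) (hconn : IsConnected (S : Set H)) (hbot : S ≠ ⊥)
    (htop : S ≠ ⊤) : ∃ W : Submodule ℝ (GroupLieAlgebra 𝓘(ℝ, EH) H),
      W ≠ ⊥ ∧ W ≠ ⊤ ∧ ∀ s ∈ S, ∀ X ∈ W, Ad s X ∈ W := by
  have : IsTopologicalGroup H := topologicalGroup_of_lieGroup 𝓘(ℝ, EH) ∞
  refine ⟨tangentSubmodule EH S, fun h ↦ ?_, fun h ↦ htop ?_,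
    fun s hs X hX ↦ Ad_mem_tangentSubmodule hs hX⟩
  · obtain ⟨X, hX0, hX⟩ := exists_isTangentTo_ne_zero (EH := EH) hconn hbot
    have h' : tangentSubmodule EH S = ⊥ := h
    exact hX0 ((Submodule.mem_bot ℝ).1 (h' ▸ mem_tangentSubmodule.2 hX))
  · have h' : tangentSubmodule EH S = ⊤ := h
    have hnhds := mem_nhds_one_of_forall_isTangentTo (EH := EH) hclosed
      fun X ↦ mem_tangentSubmodule.1 (h' ▸ Submodule.mem_top)
    have hopen := S.isOpen_of_mem_nhds hnhds
    exact SetLike.coe_injective (IsClopen.eq_univ ⟨hclosed, hopen⟩ ⟨1, S.one_mem⟩)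

end ClosedSubgroup

/-! ### Comparison with matrices -/

section StandardBasis

open LieAlgebra.SpecialLinear

/-- The coordinates `(e, h, f)` on `𝔰𝔩(2, ℝ)`. -/
def slCoord : sl (Fin 2) ℝ ≃ₗ[ℝ] (Fin 3 → ℝ) where
  toFun A := ![A.1 0 1, A.1 0 0, A.1 1 0]
  invFun c := ⟨!![c 1, c 0; c 2, -c 1], by
    change Matrix.trace !![c 1, c 0; c 2, -c 1] = 0
    simp [Matrix.trace_fin_two]⟩
  map_add' A B := by ext i; fin_cases i <;> simp
  map_smul' r A := by ext i; fin_cases i <;> simp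
  left_inv A := by
    have h : Matrix.trace A.1 = 0 := A.2
    rw [Matrix.trace_fin_two] at h
    ext i j
    fin_cases i <;> fin_cases j <;> simp
    linarith
  right_inv c := by ext i; fin_cases i <;> simp

/-- The standard basis of `𝔰𝔩(2, ℝ)`. -/
def slBasis : Module.Basis (Fin 3) ℝ (sl (Fin 2) ℝ) := Module.Basis.ofEquivFun slCoord

lemma slBasis_combination (x y z : ℝ) :
    (x • slBasis 0 + y • slBasis 1 + z • slBasis 2 : sl (Fin 2) ℝ).1 = !![y, x; z, -y] := by
  have h : x • slBasis 0 + y • slBasis 1 + z • slBasis 2 = slCoord.symm ![x, y, z] := by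
    rw [← slCoord.injective.eq_iff]
    ext i
    fin_cases i <;> simp [slBasis]
  rw [h]
  simp [slCoord]

lemma isSl2Basis_slBasis : IsSl2Basis slBasis := by
  have h0 : (slBasis 0).1 = !![0, 1; 0, 0] := by simpa using slBasis_combination 1 0 0
  have h1 : (slBasis 1).1 = !![1, 0; 0, -1] := by simpa using slBasis_combination 0 1 0
  have h2 : (slBasis 2).1 = !![0, 0; 1, 0] := by simpa using slBasis_combination 0 0 1
  refine ⟨?_, ?_, ?_⟩ <;> apply Subtype.ext <;>
    simp only [sl_bracket, SetLike.val_smul, h0, h1, h2] <;>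
    ext i j <;> fin_cases i <;> fin_cases j <;> norm_num [Matrix.mul_apply]

variable {V V' : Type*} [LieRing V] [LieAlgebra ℝ V] [LieRing V'] [LieAlgebra ℝ V']
  {b : Module.Basis (Fin 3) ℝ V} {b' : Module.Basis (Fin 3) ℝ V'}

/-- Two Lie algebras with a standard basis are isomorphic. -/
def IsSl2Basis.lieEquiv (hb : IsSl2Basis b) (hb' : IsSl2Basis b') : V ≃ₗ⁅ℝ⁆ V' :=
  { b.equiv b' (Equiv.refl _) with
    map_lie' := by
      intro X Y
      obtain ⟨x, y, z, rfl⟩ := exists_eq_combination (b := b) X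
      obtain ⟨x', y', z', rfl⟩ := exists_eq_combination (b := b) Y
      rw [hb.lie_combination]
      simp [hb'.lie_combination] }

lemma IsSl2Basis.lieEquiv_combination (hb : IsSl2Basis b) (hb' : IsSl2Basis b') (x y z : ℝ) :
    hb.lieEquiv hb' (x • b 0 + y • b 1 + z • b 2) = x • b' 0 + y • b' 1 + z • b' 2 := by
  change b.equiv b' (Equiv.refl _) _ = _
  simp

lemma IsSl2Basis.map (hb : IsSl2Basis b) (e : V ≃ₗ⁅ℝ⁆ V') :
    IsSl2Basis (b.map (e : V ≃ₗ[ℝ] V')) := by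
  refine ⟨?_, ?_, ?_⟩ <;> simp [← LieEquiv.map_lie, hb.lie_h_e, hb.lie_h_f, hb.lie_e_f]

/-- In the standard basis, a rotation is the adjoint action of a rotation matrix. -/
lemma IsSl2Basis.lieEquiv_rotation (hb : IsSl2Basis b) (θ : ℝ) (X : V) :
    (hb.lieEquiv isSl2Basis_slBasis
      (rotation b (Real.cos (2 * θ)) (Real.sin (2 * θ)) X)).1 =
      rotationMatrix θ * (hb.lieEquiv isSl2Basis_slBasis X).1 * rotationMatrix (-θ) := by
  obtain ⟨x, y, z, rfl⟩ := exists_eq_combination (b := b) X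
  rw [hb.lieEquiv_combination, slBasis_combination]
  have hrot : rotation b (Real.cos (2 * θ)) (Real.sin (2 * θ)) (x • b 0 + y • b 1 + z • b 2) =
      (x * Real.cos θ ^ 2 + y * (2 * Real.sin θ * Real.cos θ) - z * Real.sin θ ^ 2) • b 0 +
      (-x * (Real.sin θ * Real.cos θ) + y * (Real.cos θ ^ 2 - Real.sin θ ^ 2) -
        z * (Real.sin θ * Real.cos θ)) • b 1 +
      (-x * Real.sin θ ^ 2 + y * (2 * Real.sin θ * Real.cos θ) + z * Real.cos θ ^ 2) • b 2 := by
    have h := Real.sin_sq_add_cos_sq θ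
    simp only [map_add, map_smul, rotation_zero, rotation_one, rotation_two, Real.cos_two_mul,
      Real.sin_two_mul]
    match_scalars
    · linear_combination z * h
    · linear_combination y * h
    · linear_combination x * h
  rw [hrot, hb.lieEquiv_combination, slBasis_combination]
  ext i j
  fin_cases i <;> fin_cases j <;>
    simp [rotationMatrix, Matrix.mul_apply, Fin.sum_univ_two] <;> ring

end StandardBasis

/-! ### Assembling the proof -/

section Main

variable {EH : Type*} [NormedAddCommGroup EH] [NormedSpace ℝ EH]
  {H : Type*} [TopologicalSpace H] [ChartedSpace EH H] [Group H] [LieGroup 𝓘(ℝ, EH) ∞ H]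

variable (EH) in
/-- The adjoint representation of a subgroup. -/
def adjointRep (S : Subgroup H) : S →* Module.End ℝ (GroupLieAlgebra 𝓘(ℝ, EH) H) where
  toFun s := (Ad (EH := EH) (s : H)).toLinearMap
  map_one' := LinearMap.ext fun X ↦ Ad_one_apply X
  map_mul' a b := LinearMap.ext fun X ↦ Ad_mul_apply (a : H) (b : H) X

lemma isEllipticOneParameterSubgroup_of_rotation [FiniteDimensional ℝ EH] {S : Subgroup H}
    {b : Module.Basis (Fin 3) ℝ (GroupLieAlgebra 𝓘(ℝ, EH) H)} (hb : IsSl2Basis b)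
    (h : ∀ T, (∃ s, adjointRep EH S s = T) ↔
      ∃ φ : ℝ, T = rotation b (Real.cos φ) (Real.sin φ)) :
    IsEllipticOneParameterSubgroup (Ad (EH := EH) '' (S : Set H)) := by
  refine ⟨hb.lieEquiv isSl2Basis_slBasis, fun T ↦ ⟨?_, ?_⟩⟩
  · rintro ⟨s, hs, rfl⟩
    obtain ⟨φ, hφ⟩ := (h _).1 ⟨⟨s, hs⟩, rfl⟩
    -- The adjoint action doubles the angle of a rotation matrix.
    refine ⟨φ / 2, fun X ↦ ?_⟩
    rw [← hb.lieEquiv_rotation, mul_div_cancel₀ _ two_ne_zero, ← hφ]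
    rfl
  · rintro ⟨θ, hθ⟩
    obtain ⟨s, hs⟩ := (h T.toLinearMap).2 ⟨2 * θ, LinearMap.ext fun X ↦ by
      refine (hb.lieEquiv isSl2Basis_slBasis).injective (Subtype.ext ?_)
      exact (hθ X).trans (hb.lieEquiv_rotation θ X).symm⟩
    exact ⟨s, s.2, ContinuousLinearMap.ext fun X ↦ LinearMap.congr_fun hs X⟩

variable {E : Type*} [NormedAddCommGroup E] [NormedSpace ℝ E]
  {M : Type*} [TopologicalSpace M] [ChartedSpace E M] [IsManifold 𝓘(ℝ, E) ∞ M]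
  [MulAction H M] [ContMDiffSMul 𝓘(ℝ, EH) 𝓘(ℝ, E) ∞ H M]

lemma isEquivariantFamily_adjointRep [FiniteDimensional ℝ E] (g : LorentzMetric E M)
    (hconf : ∀ h : H, g.IsConformal (fun x : M ↦ h • x)) (S : Subgroup H) :
    IsEquivariantFamily (adjointRep EH S) (fun x : M ↦ isotropyAlgebra EH H (E := E) x)
      (fun x ↦ pullbackForm EH H g x) where
  mem_iff s _ _ := Ad_mem_isotropyAlgebra_smul_iff (s : H)
  form_eq s x := exists_pullbackForm_smul g (hconf s) x
  continuous_form X := continuous_pullbackForm g X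

/-- A closed invariant set contains a point whose isotropy algebra is invariant under `Ad s`, and
whose pulled back form is invariant up to scaling, for all `s ∈ S`. -/
theorem exists_Ad_conformal_point [FiniteDimensional ℝ EH] [ConnectedSpace H]
    (hH : Nonempty (GroupLieAlgebra 𝓘(ℝ, EH) H ≃ₗ⁅ℝ⁆ LieAlgebra.SpecialLinear.sl (Fin 2) ℝ))
    [FiniteDimensional ℝ E] [CompactSpace M] (g : LorentzMetric E M)
    (hconf : ∀ h : H, g.IsConformal (fun x : M ↦ h • x))
    (S : Subgroup H) (hS_proper : S ≠ ⊤) (hS_closed : IsClosed (S : Set H))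
    (hS_conn : IsConnected (S : Set H))
    (hS_ell : ¬ IsEllipticOneParameterSubgroup (Ad (EH := EH) '' (S : Set H)))
    {F : Set M} (hF_closed : IsClosed F) (hF_ne : F.Nonempty)
    (hF_inv : ∀ s ∈ S, ∀ y ∈ F, s • y ∈ F) :
    ∃ x ∈ F, ∀ s ∈ S, (∀ X ∈ isotropyAlgebra EH H (E := E) x,
      Ad s X ∈ isotropyAlgebra EH H (E := E) x) ∧
        ∃ r : ℝ, 0 < r ∧ ∀ X, pullbackForm EH H g x (Ad s X) = r * pullbackForm EH H g x X := by
  obtain ⟨e⟩ := hH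
  -- The trivial subgroup has zero tangent space and is treated apart; every point of `F` works for
  -- it.
  by_cases hbot : S = ⊥
  · obtain ⟨x, hx⟩ := hF_ne
    refine ⟨x, hx, fun s hs ↦ ?_⟩
    obtain rfl : s = 1 := by rwa [hbot, Subgroup.mem_bot] at hs
    exact ⟨fun X hX ↦ by rwa [Ad_one_apply], 1, one_pos, fun X ↦ by rw [Ad_one_apply, one_mul]⟩
  obtain ⟨W, hW0, hW1, hW⟩ := exists_Ad_invariant_submodule (EH := EH) hS_closed hS_conn hbot
    hS_proper
  have : ConnectedSpace S := isConnected_iff_connectedSpace.1 hS_conn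
  have hcont : ∀ X (φ : GroupLieAlgebra 𝓘(ℝ, EH) H →ₗ[ℝ] ℝ),
      Continuous fun s : S ↦ φ (adjointRep EH S s X) := by
    intro X φ
    have hφ : ∀ φ' : EH →ₗ[ℝ] ℝ, Continuous φ' := LinearMap.continuous_of_finiteDimensional
    exact (hφ φ).comp ((continuous_Ad_apply X).comp continuous_subtype_val)
  rcases (isSl2Basis_slBasis.map e.symm).borel_or_elliptic (ρ := adjointRep EH S)
    (fun s X Y ↦ Ad_lie (s : H) X Y) hcont hW0 hW1 (fun s X hX ↦ hW s s.2 X hX) with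
    ⟨b, hb⟩ | ⟨b, hb, hrot⟩
  · obtain ⟨x, hx, hfix⟩ := (isEquivariantFamily_adjointRep g hconf S).exists_fixed_of_borel
      (E := E) exists_continuousAt_ker_eq_isotropyAlgebra hF_closed.isCompact hF_ne
      (fun s y hy ↦ hF_inv s s.2 y hy) hb
    exact ⟨x, hx, fun s hs ↦ hfix ⟨s, hs⟩⟩
  · exact absurd (isEllipticOneParameterSubgroup_of_rotation hb hrot) hS_ell

end Main

end ConformalLorentz

end

open ConformalLorentz in
theorem mainTheorem5
    {EH : Type*} [NormedAddCommGroup EH] [NormedSpace ℝ EH] [FiniteDimensional ℝ EH]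
    {H : Type*} [TopologicalSpace H] [ChartedSpace EH H] [Group H] [LieGroup 𝓘(ℝ, EH) ∞ H]
    [ConnectedSpace H]
    -- `H` is locally isomorphic to `PSL(2, ℝ)`: its Lie algebra is `𝔰𝔩(2, ℝ)`
    (hH : Nonempty (GroupLieAlgebra 𝓘(ℝ, EH) H ≃ₗ⁅ℝ⁆ LieAlgebra.SpecialLinear.sl (Fin 2) ℝ))
    {E : Type*} [NormedAddCommGroup E] [NormedSpace ℝ E] [FiniteDimensional ℝ E]
    (hn : 3 ≤ Module.finrank ℝ E)
    {M : Type*} [TopologicalSpace M] [ChartedSpace E M] [IsManifold 𝓘(ℝ, E) ∞ M]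
    [T2Space M] [CompactSpace M] [ConnectedSpace M]
    (g : LorentzMetric E M)
    [MulAction H M] [ContMDiffSMul 𝓘(ℝ, EH) 𝓘(ℝ, E) ∞ H M]
    (hconf : ∀ h : H, g.IsConformal (fun x : M ↦ h • x))
    (S : Subgroup H) (hS_proper : S ≠ ⊤) (hS_closed : IsClosed (S : Set H))
    (hS_conn : IsConnected (S : Set H))
    (hS_ell : ¬ IsEllipticOneParameterSubgroup (Ad (EH := EH) '' (S : Set H)))
    (F : Set M) (hF_closed : IsClosed F) (hF_ne : F.Nonempty)
    (hF_inv : ∀ s ∈ S, ∀ y ∈ F, s • y ∈ F) :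
    ∃ x ∈ F,
      ∃ hx : ∀ s ∈ S, isotropyAlgebra EH H (E := E) x ≤
          (isotropyAlgebra EH H (E := E) x).comap (Ad (EH := EH) s).toLinearMap,
        ∀ s (hs : s ∈ S), ∃ c : ℝ, 0 < c ∧
          ∀ v : GroupLieAlgebra 𝓘(ℝ, EH) H ⧸ isotropyAlgebra EH H (E := E) x,
            orbitQuadraticForm EH H g x
                ((isotropyAlgebra EH H (E := E) x).mapQ (isotropyAlgebra EH H (E := E) x)
                  (Ad (EH := EH) s).toLinearMap (hx s hs) v)
              = c * orbitQuadraticForm EH H g x v := by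
  obtain ⟨x, hx, h⟩ := exists_Ad_conformal_point hH g hconf S hS_proper hS_closed hS_conn hS_ell
    hF_closed hF_ne hF_inv
  refine ⟨x, hx, fun s hs X hX ↦ (h s hs).1 X hX, fun s hs ↦ ?_⟩
  obtain ⟨c, hc, hQ⟩ := (h s hs).2
  exact ⟨c, hc, fun v ↦ Submodule.Quotient.induction_on _ v hQ⟩
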